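/- Let $d\ge 1$ be an integer and let $\varepsilon>0$, $m>2$ and $M>0$ be real numbers. Let $W:\mathbb{R}^d\to\mathbb{R}$ and $\omega:(0,\infty)\to\mathbb{R}$ satisfy the following conditions. (W1) $W\in C^1(\mathbb{R}^d\setminus\{0\})$, and $W(x)=\omega(\|x\|)$ for all $x\neq 0$, where $\|\cdot\|$ is the Euclidean norm. (W2) There is a constant $C_\omega>0$ such that $\omega'(r)\le C_\omega r^{1-d}$ for all $0<r\le 1$. (W4) $\omega'(r)>0$ for all $0<r<1$, and $\omega'(r)=\omega(r)=0$ for all $r\ge 1$. Let $\mathcal{Y}_M$ be the set of all $\rho\in L^1(\mathbb{R}^d)\cap L^m(\mathbb{R}^d)$ with $\rho\ge 0$ almost everywhere and $\|\rho\|_{L^1(\mathbb{R}^d)}=M$, and for $\rho\in\mathcal{Y}_M$ let $$\mathcal{E}[\rho]=\frac{\varepsilon}{m-1}\int_{\mathbb{R}^d}\rho^m\,dx+\frac12\int_{\mathbb{R}^d}\rho\,(W*\rho)\,dx,\qquad (W*\rho)(x)=\int_{\mathbb{R}^d}W(x-y)\rho(y)\,dy .$$ Suppose that $\bar\rho\in\mathcal{Y}_M$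 is a global minimizer, that is, $\mathcal{E}[\bar\rho]\le\mathcal{E}[\rho]$ for all $\rho\in\mathcal{Y}_M$, and that the support of $\bar\rho$ (the complement of the largest open set on which $\bar\rho=0$ almost everywhere) is connected. Then $\bar\rho$ is radially symmetric and decreasing up to a translation: there exist a point $x_0\in\mathbb{R}^d$ and a non-increasing function $g:[0,\infty)\to[0,\infty)$ such that $\bar\rho(x)=g(\|x-x_0\|)$ for almost every $x\in\mathbb{R}^d$. -/

import Mathlib

open MeasureTheory Set Filter Topology

noncomputable section

namespace AggDiff

/-- Condition (W1): `W` is continuously differentiable away from the origin and radially symmetric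
with profile `ω`. Only the values of `ω` on `(0, ∞)` are used; `W 0` is unrestricted. -/
def CondW1 {d : ℕ} (W : EuclideanSpace ℝ (Fin d) → ℝ) (ω : ℝ → ℝ) : Prop :=
  ContDiffOn ℝ 1 W {0}ᶜ ∧ ∀ x, x ≠ 0 → W x = ω ‖x‖

/-- Condition (W2): `ω'(r) ≤ C r^(1-d)` for `0 < r ≤ 1`, with some constant `C > 0`. -/
def CondW2 (d : ℕ) (ω : ℝ → ℝ) : Prop :=
  ∃ C : ℝ, 0 < C ∧ ∀ r : ℝ, 0 < r → r ≤ 1 → deriv ω r ≤ C * r ^ (1 - (d : ℝ))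

/-- Condition (W4): `ω' > 0` on `(0, 1)` and `ω' = ω = 0` on `[1, ∞)`. -/
def CondW4 (ω : ℝ → ℝ) : Prop :=
  (∀ r : ℝ, 0 < r → r < 1 → 0 < deriv ω r) ∧
    ∀ r : ℝ, 1 ≤ r → deriv ω r = 0 ∧ ω r = 0

/-- The convolution `(W * ρ)(x) = ∫ W(x - y) ρ(y) dy`. -/
def conv {d : ℕ} (W ρ : EuclideanSpace ℝ (Fin d) → ℝ) (x : EuclideanSpace ℝ (Fin d)) : ℝ :=
  ∫ y, W (x - y) * ρ y

/-- The energy `ε / (m - 1) ∫ ρ^m dx + 1/2 ∫ ρ (W * ρ) dx`. -/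
def energy {d : ℕ} (ε m : ℝ) (W ρ : EuclideanSpace ℝ (Fin d) → ℝ) : ℝ :=
  ε / (m - 1) * (∫ x, ρ x ^ m) + 1 / 2 * ∫ x, ρ x * conv W ρ x

/-- The admissible class of (representatives of) nonnegative functions in `L¹ ∩ L^m` with mass
`M`; by nonnegativity the `L¹` norm is the integral. -/
def admissible (d : ℕ) (m M : ℝ) : Set (EuclideanSpace ℝ (Fin d) → ℝ) :=
  {ρ | MemLp ρ 1 volume ∧ MemLp ρ (ENNReal.ofReal m) volume ∧ (∀ᵐ x, 0 ≤ ρ x) ∧ ∫ x, ρ x = M}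

/-- `ρ` is a global minimizer of the energy in the admissible class. -/
def IsGlobalMinimizer {d : ℕ} (ε m M : ℝ) (W ρ : EuclideanSpace ℝ (Fin d) → ℝ) : Prop :=
  ρ ∈ admissible d m M ∧ ∀ η ∈ admissible d m M, energy ε m W ρ ≤ energy ε m W η

/-- The support of the almost-everywhere class of `ρ`: the complement of the largest open set on
which `ρ` vanishes almost everywhere. -/
def essSupport {d : ℕ} (ρ : EuclideanSpace ℝ (Fin d) → ℝ) : Set (EuclideanSpace ℝ (Fin d)) :=
  {x | ∀ U ∈ 𝓝 x, 0 < volume (U ∩ {y | ρ y ≠ 0})}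

/-- A nonnegative function is radially symmetric and decreasing up to a translation if it is a
non-increasing function, defined on `[0, ∞)`, of the distance to some centre `x₀`. -/
def IsRadiallyDecreasing {d : ℕ} (f : EuclideanSpace ℝ (Fin d) → ℝ) : Prop :=
  (∀ x, 0 ≤ f x) ∧ ∃ (x₀ : EuclideanSpace ℝ (Fin d)) (g : ℝ → ℝ),
    (∀ x, f x = g ‖x - x₀‖) ∧ AntitoneOn g (Ici 0)

end AggDiff

end

/-! The proof combines polarization with a continuation argument inside the support. For a
hyperplane with reflection `σ`, call `f x - f (σ x)` the asymmetry of `f`. Polarization, which moves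
the larger value of each reflected pair to one side, preserves the mass and `∫ f ^ m`. It does not
raise the interaction energy, since `W` increases with distance. The energy drops strictly as soon
as the asymmetry takes opposite signs at two points on one side at distance less than one
(`asymmetry_mul_nonneg`). For a minimizer the sign is therefore locally constant in this sense; as
`W` has range one, opposite signs could still occur far apart.

Connectedness of the support excludes this (`IsEquilibrium.asym_sign`). The Euler–Lagrange
conditions give a continuous representative which is a decreasing function of its own potential `V`
where it is positive (`exists_equilibrium`). At a limit point of the set of positive asymmetry, the
sign condition holds within unit distance, which yields `V x < V (σ x)` off the hyperplane
(`conv_lt_conv_refl`). On the hyperplane a Hopf-type argument gives the same inequality at nearby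
points of the positive side (`eventually_conv_lt_conv_refl`). Hence `f x > f (σ x)` persists nearby,
and the closed set where this sign prevails is also relatively open in the support.

So every hyperplane has a signed asymmetry. Since the integral of the asymmetry over a half-space
compares the masses of the two sides, a hyperplane halving the mass is one of symmetry. Halving
hyperplanes in the coordinate directions produce a centre, bisectors through the centre give radial
symmetry, and the remaining bisectors give monotonicity (`AsymSigned.isRadiallyDecreasing`). -/

namespace AggDiff

/-! ### The attractive kernel and its radial profile -/

section

/-- Euclidean space of dimension `d`. -/
abbrev Euc (d : ℕ) := EuclideanSpace ℝ (Fin d)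

/-- An integrable radial kernel which is attractive with range one: it increases strictly with the
distance up to distance one, vanishes beyond, and has a continuous derivative in between. -/
structure AttractiveKernel {d : ℕ} (W : Euc d → ℝ) : Prop where
  integrable : Integrable W
  radial : ∀ x y, ‖x‖ = ‖y‖ → W x = W y
  eq_zero : ∀ x, 1 ≤ ‖x‖ → W x = 0
  mono : ∀ x y, x ≠ 0 → ‖x‖ ≤ ‖y‖ → W x ≤ W y
  strict : ∀ x y, x ≠ 0 → ‖x‖ < 1 → ‖x‖ < ‖y‖ → W x < W y
  continuousAt : ∀ x, x ≠ 0 → ContinuousAt W x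
  growth : ∀ τ, 0 < τ → ∃ c, 0 < c ∧ ∀ x y, τ ≤ ‖x‖ → ‖x‖ ≤ ‖y‖ → ‖y‖ ≤ 1 - τ →
    c * (‖y‖ - ‖x‖) ≤ W y - W x
  flat : ∀ η, 0 < η → ∃ δ, 0 < δ ∧ δ < 1 ∧ ∀ x y, 1 - δ ≤ ‖x‖ → 1 - δ ≤ ‖y‖ →
    |W x - W y| ≤ η * |‖x‖ - ‖y‖|

variable {d : ℕ} {W : Euc d → ℝ} {ω : ℝ → ℝ}

lemma profile_contDiffOn (hd : 1 ≤ d) (h1 : CondW1 W ω) : ContDiffOn ℝ 1 ω (Ioi 0) := by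
  set e : Euc d := EuclideanSpace.single ⟨0, hd⟩ 1 with he
  have hne : ‖e‖ = 1 := by simp [he]
  have he0 : e ≠ 0 := by intro h; simp [h] at hne
  have h : ContDiffOn ℝ 1 (fun r : ℝ => W (r • e)) (Ioi 0) := by
    refine h1.1.comp (g := W) (f := fun r : ℝ => r • e) ?_ ?_
    · exact (contDiff_id.smul contDiff_const).contDiffOn
    · intro r hr
      simp only [mem_compl_iff, mem_singleton_iff, smul_eq_zero, not_or]
      exact ⟨(mem_Ioi.1 hr).ne', he0⟩
  refine h.congr fun r hr => ?_
  have hr' : (0 : ℝ) < r := hr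
  rw [h1.2 _ (smul_ne_zero hr'.ne' he0), norm_smul, hne, mul_one, Real.norm_of_nonneg hr'.le]

lemma profile_differentiableAt (hc : ContDiffOn ℝ 1 ω (Ioi 0)) {r : ℝ} (hr : 0 < r) :
    DifferentiableAt ℝ ω r :=
  (hc.differentiableOn one_ne_zero).differentiableAt (Ioi_mem_nhds hr)

lemma profile_continuousOn_deriv (hc : ContDiffOn ℝ 1 ω (Ioi 0)) :
    ContinuousOn (deriv ω) (Ioi 0) :=
  hc.continuousOn_deriv_of_isOpen isOpen_Ioi le_rfl

lemma profile_deriv_nonneg (h4 : CondW4 ω) {r : ℝ} (hr : 0 < r) : 0 ≤ deriv ω r := by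
  rcases lt_or_ge r 1 with h | h
  · exact (h4.1 r hr h).le
  · exact (h4.2 r h).1.ge

lemma profile_monotoneOn (hc : ContDiffOn ℝ 1 ω (Ioi 0)) (h4 : CondW4 ω) :
    MonotoneOn ω (Ioi 0) := by
  refine monotoneOn_of_deriv_nonneg (convex_Ioi 0) hc.continuousOn ?_ ?_
  · rw [interior_Ioi]; exact hc.differentiableOn one_ne_zero
  · rw [interior_Ioi]; exact fun r hr => profile_deriv_nonneg h4 hr

lemma profile_strictMonoOn (hc : ContDiffOn ℝ 1 ω (Ioi 0)) (h4 : CondW4 ω) :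
    StrictMonoOn ω (Ioc 0 1) := by
  refine strictMonoOn_of_deriv_pos (convex_Ioc 0 1) (hc.continuousOn.mono Ioc_subset_Ioi_self) ?_
  rw [interior_Ioc]; exact fun r hr => h4.1 r hr.1 hr.2

lemma profile_lt (hc : ContDiffOn ℝ 1 ω (Ioi 0)) (h4 : CondW4 ω) {r s : ℝ} (hr : 0 < r)
    (hr1 : r < 1) (hrs : r < s) : ω r < ω s := by
  have h0 : 0 < min s 1 := lt_min (hr.trans hrs) one_pos
  exact (profile_strictMonoOn hc h4 ⟨hr, hr1.le⟩ ⟨h0, min_le_right _ _⟩ (lt_min hrs hr1)).trans_le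
    (profile_monotoneOn hc h4 h0 (hr.trans hrs) (min_le_left _ _))

lemma profile_growth (hc : ContDiffOn ℝ 1 ω (Ioi 0)) (h4 : CondW4 ω) {τ : ℝ} (hτ : 0 < τ) :
    ∃ c, 0 < c ∧ ∀ r s, τ ≤ r → r ≤ s → s ≤ 1 - τ → c * (s - r) ≤ ω s - ω r := by
  -- If `1 - τ < τ`, no pair `r ≤ s` is admitted and any constant serves.
  rcases lt_or_ge (1 - τ) τ with hlt | hle
  · exact ⟨1, one_pos, fun r s h1 h2 h3 => by linarith⟩
  have hsub : Icc τ (1 - τ) ⊆ Ioi 0 := fun x hx => hτ.trans_le hx.1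
  obtain ⟨x, hx, hmin⟩ := isCompact_Icc.exists_isMinOn (nonempty_Icc.2 hle)
    ((profile_continuousOn_deriv hc).mono hsub)
  refine ⟨deriv ω x, h4.1 x (hsub hx) (by linarith [hx.2]), fun r s h1 h2 h3 => ?_⟩
  refine (convex_Icc τ (1 - τ)).mul_sub_le_image_sub_of_le_deriv (hc.continuousOn.mono hsub) ?_ ?_
    r ⟨h1, h2.trans h3⟩ s ⟨h1.trans h2, h3⟩ h2
  · exact (hc.differentiableOn one_ne_zero).mono (interior_subset.trans hsub)
  · exact fun y hy => isMinOn_iff.1 hmin y (interior_subset hy)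

/-- Since `ω` is `C¹` across `r = 1` and `ω' 1 = 0`, its Lipschitz constant on `[1 - δ, ∞)` is
arbitrarily small. This later controls the far interactions, where the sign of the asymmetry is
unknown. -/
lemma profile_flat (hc : ContDiffOn ℝ 1 ω (Ioi 0)) (h4 : CondW4 ω) {η : ℝ} (hη : 0 < η) :
    ∃ δ, 0 < δ ∧ δ < 1 ∧ ∀ r s, 1 - δ ≤ r → 1 - δ ≤ s → |ω r - ω s| ≤ η * |r - s| := by
  have hcont : ContinuousAt (deriv ω) 1 :=
    (profile_continuousOn_deriv hc).continuousAt (Ioi_mem_nhds one_pos)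
  have hev : ∀ᶠ r in 𝓝 (1 : ℝ), deriv ω r < η := by
    apply hcont.eventually_lt_const
    rw [(h4.2 1 le_rfl).1]; exact hη
  obtain ⟨δ, hδ, hball⟩ := Metric.eventually_nhds_iff.1 hev
  refine ⟨min (δ / 2) (1 / 2), by positivity, by
    exact (min_le_right _ _).trans_lt (by norm_num), fun r s hr hs => ?_⟩
  set t := 1 - min (δ / 2) (1 / 2) with ht
  have ht0 : 0 < t := by have := min_le_right (δ / 2) (1 / 2 : ℝ); linarith
  have htδ : 1 - δ / 2 ≤ t := by have := min_le_left (δ / 2) (1 / 2 : ℝ); linarith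
  have hbound : ∀ y ∈ Ici t, ‖deriv ω y‖ ≤ η := by
    intro y hy
    have hy0 : 0 < y := ht0.trans_le hy
    rw [Real.norm_of_nonneg (profile_deriv_nonneg h4 hy0)]
    rcases lt_or_ge y 1 with h | h
    · refine (hball ?_).le
      rw [Real.dist_eq, abs_lt]
      have : t ≤ y := hy
      constructor <;> linarith
    · rw [(h4.2 y h).1]; exact hη.le
  have := (convex_Ici t).norm_image_sub_le_of_norm_deriv_le
    (fun y hy => profile_differentiableAt hc (ht0.trans_le hy)) hbound hs hr
  simpa [Real.norm_eq_abs] using this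

/-- Integrate the derivative bound from `r` to `1`, where `ω` vanishes. Weakening `r ^ (1 - d)` to
`r ^ (-a - 1)` with `a > 0` avoids a separate logarithmic case in dimension two. -/
lemma profile_lower_bound (hc : ContDiffOn ℝ 1 ω (Ioi 0)) (h2 : CondW2 d ω) (h4 : CondW4 ω)
    {a : ℝ} (ha : 0 < a) (had : (d : ℝ) - 2 ≤ a) :
    ∃ C, 0 ≤ C ∧ ∀ r, 0 < r → r ≤ 1 → |ω r| ≤ C * r ^ (-a) := by
  obtain ⟨C, hC, hb⟩ := h2
  refine ⟨C / a, by positivity, fun r hr hr1 => ?_⟩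
  have hanti : AntitoneOn (fun s => ω s + C / a * s ^ (-a)) (Icc r 1) := by
    have hd1 : ∀ s, 0 < s → HasDerivAt (fun s => ω s + C / a * s ^ (-a))
        (deriv ω s + C / a * (-a * s ^ (-a - 1))) s := fun s hs =>
      (profile_differentiableAt hc hs).hasDerivAt.add
        ((Real.hasDerivAt_rpow_const (Or.inl hs.ne')).const_mul _)
    refine antitoneOn_of_deriv_nonpos (convex_Icc r 1) ?_ ?_ ?_
    · exact fun s hs => (hd1 s (hr.trans_le hs.1)).continuousAt.continuousWithinAt
    · rw [interior_Icc]
      exact fun s hs => (hd1 s (hr.trans hs.1)).differentiableAt.differentiableWithinAt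
    · rw [interior_Icc]
      intro s hs
      have hs0 : 0 < s := hr.trans hs.1
      rw [(hd1 s hs0).deriv]
      have e1 : C / a * (-a * s ^ (-a - 1)) = - (C * s ^ (-a - 1)) := by field_simp
      have e2 : s ^ (1 - (d : ℝ)) ≤ s ^ (-a - 1) :=
        Real.rpow_le_rpow_of_exponent_ge hs0 hs.2.le (by linarith)
      rw [e1]
      have := hb s hs0 hs.2.le
      nlinarith
  have h1 := hanti (left_mem_Icc.2 hr1) (right_mem_Icc.2 hr1) hr1
  simp only [Real.one_rpow, mul_one, (h4.2 1 le_rfl).2, zero_add] at h1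
  have h0 : ω r ≤ 0 := (profile_monotoneOn hc h4 hr (mem_Ioi.2 one_pos) hr1).trans_eq (h4.2 1 le_rfl).2
  rw [abs_of_nonpos h0]
  have : 0 ≤ C / a := by positivity
  linarith

lemma kernel_integrable (hd : 1 ≤ d) (h1 : CondW1 W ω) (h2 : CondW2 d ω) (h4 : CondW4 ω) :
    Integrable W := by
  have hc := profile_contDiffOn hd h1
  have : Nonempty (Fin d) := ⟨⟨0, hd⟩⟩
  have hd1 : (1 : ℝ) ≤ d := by exact_mod_cast hd
  have hW : W =ᵐ[volume] fun x => ω ‖x‖ := by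
    filter_upwards [compl_mem_ae_iff.2 (measure_singleton (0 : Euc d))] with x hx
    exact h1.2 x hx
  refine Integrable.congr ?_ hW.symm
  rw [integrable_fun_norm_addHaar]
  -- The exponent `d - 1/2` is positive for every `d ≥ 1`, and with the Jacobian `r ^ (d - 1)` it
  -- leaves the integrable singularity `r ^ (-1/2)`.
  obtain ⟨C, hC, hb⟩ := profile_lower_bound (a := d - 1 / 2) hc h2 h4 (by linarith) (by linarith)
  have hcont : ContinuousOn (fun y : ℝ => y ^ (Module.finrank ℝ (Euc d) - 1) • ω y) (Ioi 0) :=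
    (continuousOn_id.pow _).smul hc.continuousOn
  have hI : IntegrableOn (fun y : ℝ => C * y ^ (-(1 / 2) : ℝ)) (Ioc 0 1) := by
    have := intervalIntegral.intervalIntegrable_rpow' (a := 0) (b := 1) (r := -(1 / 2))
      (by norm_num)
    rw [intervalIntegrable_iff_integrableOn_Ioc_of_le zero_le_one] at this
    exact this.const_mul C
  rw [← Ioc_union_Ioi_eq_Ioi (zero_le_one' ℝ), integrableOn_union]
  constructor
  · refine Integrable.mono' hI ((hcont.mono Ioc_subset_Ioi_self).aestronglyMeasurable
      measurableSet_Ioc) ?_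
    filter_upwards [ae_restrict_mem measurableSet_Ioc] with y hy
    have hy0 : 0 < y := hy.1
    rw [norm_smul, norm_pow, Real.norm_of_nonneg hy0.le, Real.norm_eq_abs]
    calc y ^ (Module.finrank ℝ (Euc d) - 1) * |ω y|
        ≤ y ^ (Module.finrank ℝ (Euc d) - 1) * (C * y ^ (-((d : ℝ) - 1 / 2))) := by
          gcongr; exact hb y hy0 hy.2
      _ = C * y ^ (-(1 / 2) : ℝ) := by
          rw [← Real.rpow_natCast, mul_left_comm, ← Real.rpow_add hy0]
          congr 2
          simp only [finrank_euclideanSpace, Fintype.card_fin]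
          rw [Nat.cast_sub hd]; push_cast; ring
  · refine (integrableOn_congr_fun (g := fun _ => (0 : ℝ)) ?_ measurableSet_Ioi).2 integrableOn_zero
    intro y hy
    simp [(h4.2 y (le_of_lt hy)).2]

lemma attractiveKernel (hd : 1 ≤ d) (h1 : CondW1 W ω) (h2 : CondW2 d ω) (h4 : CondW4 ω) :
    AttractiveKernel W := by
  have hc := profile_contDiffOn hd h1
  have hpos : ∀ x : Euc d, 0 < ‖x‖ → W x = ω ‖x‖ := fun x hx => h1.2 x (norm_pos_iff.1 hx)
  refine ⟨kernel_integrable hd h1 h2 h4, fun x y h => ?_, fun x hx => ?_, fun x y hx h => ?_,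
    fun x y hx hx1 h => ?_, fun x hx => ?_, fun τ hτ => ?_, fun η hη => ?_⟩
  · by_cases hx : x = 0
    · subst hx
      rw [norm_zero, eq_comm, norm_eq_zero] at h
      rw [h]
    · have hx' := norm_pos_iff.2 hx
      rw [hpos x hx', hpos y (h ▸ hx'), h]
  · rw [hpos x (one_pos.trans_le hx), (h4.2 _ hx).2]
  · have hx' := norm_pos_iff.2 hx
    rw [hpos x hx', hpos y (hx'.trans_le h)]
    exact profile_monotoneOn hc h4 hx' (hx'.trans_le h) h
  · have hx' := norm_pos_iff.2 hx
    rw [hpos x hx', hpos y (hx'.trans h)]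
    exact profile_lt hc h4 hx' hx1 h
  · exact h1.1.continuousOn.continuousAt (isOpen_compl_singleton.mem_nhds hx)
  · obtain ⟨c, hc0, hb⟩ := profile_growth hc h4 hτ
    refine ⟨c, hc0, fun x y hx hxy hy => ?_⟩
    rw [hpos x (hτ.trans_le hx), hpos y (hτ.trans_le (hx.trans hxy))]
    exact hb _ _ hx hxy hy
  · obtain ⟨δ, hδ, hδ1, hb⟩ := profile_flat hc h4 hη
    refine ⟨δ, hδ, hδ1, fun x y hx hy => ?_⟩
    rw [hpos x (by linarith), hpos y (by linarith)]
    exact hb _ _ hx hy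

end

/-! ### The interaction energy and its first variation -/

section

variable {d : ℕ} {W : Euc d → ℝ}

lemma AttractiveKernel.sub_comm (hW : AttractiveKernel W) (x y : Euc d) : W (x - y) = W (y - x) :=
  hW.radial _ _ (norm_sub_rev x y)

lemma AttractiveKernel.nonpos (hW : AttractiveKernel W) {x : Euc d} (hx : x ≠ 0) : W x ≤ 0 := by
  rcases le_or_gt 1 ‖x‖ with h | h
  · exact (hW.eq_zero x h).le
  · have h1 : ‖‖x‖⁻¹ • x‖ = 1 := norm_smul_inv_norm hx
    rw [← hW.eq_zero _ h1.ge]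
    exact hW.mono _ _ hx (h1 ▸ h.le)

/-- By `t² ≤ t + t ^ m` for `t ≥ 0`. Square integrability is what makes the interaction with an
integrable kernel absolutely convergent. -/
lemma memLp_two {ρ : Euc d → ℝ} {m : ℝ} (hm : 2 < m) (h1 : MemLp ρ 1 volume)
    (hmm : MemLp ρ (ENNReal.ofReal m) volume) : MemLp ρ 2 volume := by
  rw [memLp_two_iff_integrable_sq h1.aestronglyMeasurable]
  have hi1 : Integrable ρ := memLp_one_iff_integrable.1 h1
  have hi2 := hmm.integrable_norm_rpow (by simp; linarith) ENNReal.ofReal_ne_top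
  rw [ENNReal.toReal_ofReal (by linarith)] at hi2
  refine (hi1.norm.add hi2).mono' (h1.aestronglyMeasurable.pow 2) (ae_of_all _ fun x => ?_)
  simp only [Pi.add_apply, norm_pow]
  have h0 := norm_nonneg (ρ x)
  rcases le_total ‖ρ x‖ 1 with h | h
  · have : 0 ≤ ‖ρ x‖ ^ m := by positivity
    nlinarith
  · have : ‖ρ x‖ ^ (2 : ℝ) ≤ ‖ρ x‖ ^ m := Real.rpow_le_rpow_of_exponent_le h hm.le
    rw [Real.rpow_two] at this
    linarith

lemma aestronglyMeasurable_kernel (hW : Integrable W) :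
    AEStronglyMeasurable (fun p : Euc d × Euc d => W (p.1 - p.2)) (volume.prod volume) :=
  hW.aestronglyMeasurable.comp_quasiMeasurePreserving
    (quasiMeasurePreserving_sub volume volume)

/-- Dominate `|f g|` by `f² + g²`; each square against `|W|` is a convolution integrand of two
integrable functions. -/
lemma integrable_interaction (hW : Integrable W) {f g : Euc d → ℝ} (hf : MemLp f 2 volume)
    (hg : MemLp g 2 volume) :
    Integrable (fun p : Euc d × Euc d => f p.1 * (g p.2 * W (p.1 - p.2)))
      (volume.prod volume) := by
  have hg2 : Integrable (fun p : Euc d × Euc d => g p.2 ^ 2 * |W (p.1 - p.2)|)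
      (volume.prod volume) :=
    hg.integrable_sq.convolution_integrand (ContinuousLinearMap.mul ℝ ℝ) hW.abs
  have hf2 : Integrable (fun p : Euc d × Euc d => f p.1 ^ 2 * |W (p.1 - p.2)|)
      (volume.prod volume) := by
    have := (hf.integrable_sq.convolution_integrand (ContinuousLinearMap.mul ℝ ℝ)
      (hW.comp_neg.abs)).swap
    refine this.congr (ae_of_all _ fun p => ?_)
    simp
  refine (hf2.add hg2).mono' ?_ (ae_of_all _ fun p => ?_)
  · exact hf.aestronglyMeasurable.comp_fst.mul
      (hg.aestronglyMeasurable.comp_snd.mul (aestronglyMeasurable_kernel hW))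
  · simp only [Pi.add_apply, Real.norm_eq_abs, abs_mul]
    have h0 := abs_nonneg (W (p.1 - p.2))
    have h1 : |f p.1| * |g p.2| ≤ f p.1 ^ 2 + g p.2 ^ 2 := by
      rw [← sq_abs (f p.1), ← sq_abs (g p.2)]
      nlinarith [sq_nonneg (|f p.1| - |g p.2|), sq_nonneg (|f p.1|), sq_nonneg (|g p.2|)]
    nlinarith

/-- The bilinear interaction energy `∫∫ f(x) g(y) W(x - y) dx dy`. -/
noncomputable def interaction (W f g : Euc d → ℝ) : ℝ :=
  ∫ p : Euc d × Euc d, f p.1 * (g p.2 * W (p.1 - p.2)) ∂(volume.prod volume)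

lemma mul_conv_eq (W f g : Euc d → ℝ) (x : Euc d) :
    f x * conv W g x = ∫ y, f x * (g y * W (x - y)) := by
  rw [integral_const_mul]; simp only [conv, mul_comm]

lemma integral_mul_conv (hW : Integrable W) {f g : Euc d → ℝ} (hf : MemLp f 2 volume)
    (hg : MemLp g 2 volume) : ∫ x, f x * conv W g x = interaction W f g := by
  rw [interaction, integral_prod _ (integrable_interaction hW hf hg)]
  simp only [mul_conv_eq]

lemma integrable_mul_conv (hW : Integrable W) {f g : Euc d → ℝ} (hf : MemLp f 2 volume)
    (hg : MemLp g 2 volume) : Integrable fun x => f x * conv W g x := by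
  simp only [mul_conv_eq]
  exact (integrable_interaction hW hf hg).integral_prod_left

lemma interaction_comm (hW : AttractiveKernel W) (f g : Euc d → ℝ) :
    interaction W f g = interaction W g f := by
  rw [interaction, ← integral_prod_swap, interaction]
  refine integral_congr_ae (ae_of_all _ fun p => ?_)
  simp only [Prod.fst_swap, Prod.snd_swap]
  rw [hW.sub_comm]; ring

lemma interaction_add_smul (hW : AttractiveKernel W) {f g : Euc d → ℝ} (hf : MemLp f 2 volume)
    (hg : MemLp g 2 volume) (t : ℝ) :
    interaction W (fun x => f x + t * g x) (fun x => f x + t * g x) =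
      interaction W f f + 2 * t * interaction W g f + t ^ 2 * interaction W g g := by
  have e : 2 * t * interaction W g f = t * interaction W g f + t * interaction W f g := by
    rw [interaction_comm hW f g]; ring
  have i1 := integrable_interaction hW.integrable hf hf
  have i2 := (integrable_interaction hW.integrable hg hf).const_mul t
  have i3 := (integrable_interaction hW.integrable hf hg).const_mul t
  have i4 := (integrable_interaction hW.integrable hg hg).const_mul (t ^ 2)
  have i5 := i1.add (i2.add i3)
  have e2 := integral_add i5 i4
  have e3 := integral_add i1 (i2.add i3)
  have e4 := integral_add i2 i3
  simp only [Pi.add_apply] at e2 e3 e4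
  rw [e]
  simp only [interaction]
  rw [← integral_const_mul, ← integral_const_mul, ← integral_const_mul, ← e4, ← e3, ← e2]
  refine integral_congr_ae (ae_of_all _ fun p => ?_)
  simp only
  ring

lemma conv_congr {f g : Euc d → ℝ} (h : f =ᵐ[volume] g) : conv W f = conv W g := by
  funext x
  refine integral_congr_ae ?_
  filter_upwards [h] with y hy
  rw [hy]

lemma energy_congr {ε m : ℝ} {f g : Euc d → ℝ} (h : f =ᵐ[volume] g) :
    energy ε m W f = energy ε m W g := by
  unfold energy
  rw [conv_congr h]
  congr 2
  · exact integral_congr_ae (by filter_upwards [h] with y hy; rw [hy])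
  · exact integral_congr_ae (by filter_upwards [h] with y hy; rw [hy])

lemma admissible_congr {m M : ℝ} {f g : Euc d → ℝ} (h : f =ᵐ[volume] g)
    (hf : f ∈ admissible d m M) : g ∈ admissible d m M := by
  obtain ⟨h1, h2, h3, h4⟩ := hf
  refine ⟨(memLp_congr_ae h).1 h1, (memLp_congr_ae h).1 h2, ?_, (integral_congr_ae h) ▸ h4⟩
  filter_upwards [h, h3] with x hx hx'
  rwa [← hx]

lemma IsGlobalMinimizer.congr {ε m M : ℝ} {f g : Euc d → ℝ} (hf : IsGlobalMinimizer ε m M W f)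
    (h : f =ᵐ[volume] g) : IsGlobalMinimizer ε m M W g :=
  ⟨admissible_congr h hf.1, fun η hη => energy_congr (W := W) h ▸ hf.2 η hη⟩

/-- The tangent line inequality for `t ↦ t ^ m`. -/
lemma rpow_tangent_le {m a b : ℝ} (hm : 1 < m) (ha : 0 ≤ a) (hb : 0 ≤ b) :
    b ^ m + m * b ^ (m - 1) * (a - b) ≤ a ^ m := by
  rcases hb.eq_or_lt with rfl | hb
  · rw [Real.zero_rpow (by linarith), Real.zero_rpow (by linarith)]
    simpa using Real.rpow_nonneg ha m
  · have h := one_add_mul_self_le_rpow_one_add (s := a / b - 1) (p := m)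
      (by have : 0 ≤ a / b := by positivity
          linarith) hm.le
    rw [add_sub_cancel, Real.div_rpow ha hb.le, le_div_iff₀ (by positivity)] at h
    have e : b ^ m = b ^ (m - 1) * b := by
      rw [← Real.rpow_add_one hb.ne', sub_add_cancel]
    calc _ = (1 + m * (a / b - 1)) * b ^ m := by rw [e]; field_simp
      _ ≤ _ := h

lemma admissible_segment {m M t : ℝ} (ht0 : 0 ≤ t) (ht1 : t ≤ 1) {ρ η : Euc d → ℝ}
    (hρ : ρ ∈ admissible d m M) (hη : η ∈ admissible d m M) :
    (fun x => ρ x + t * (η x - ρ x)) ∈ admissible d m M := by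
  obtain ⟨h1, h2, h3, h4⟩ := hρ
  obtain ⟨k1, k2, k3, k4⟩ := hη
  refine ⟨h1.add ((k1.sub h1).const_mul t), h2.add ((k2.sub h2).const_mul t), ?_, ?_⟩
  · filter_upwards [h3, k3] with x hx kx
    nlinarith [mul_nonneg ht0 kx, mul_nonneg (sub_nonneg.2 ht1) hx]
  · have i1 := memLp_one_iff_integrable.1 h1
    have i2 := memLp_one_iff_integrable.1 k1
    have e1 := integral_add i1 ((i2.sub i1).const_mul t)
    have e2 := integral_sub i2 i1
    simp only [Pi.sub_apply] at e1 e2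
    rw [e1, integral_const_mul, e2, h4, k4]; ring

/-- The majorant depends only on `f` and `g`, so it serves for dominated convergence along a whole
segment of densities. -/
lemma integrable_rpow_mul {m : ℝ} (hm : 2 < m) {f g u v : Euc d → ℝ}
    (hf : MemLp f (ENNReal.ofReal m) volume) (hg : MemLp g (ENNReal.ofReal m) volume)
    (hu : AEStronglyMeasurable u volume) (hv : AEStronglyMeasurable v volume)
    (hu0 : ∀ᵐ x, 0 ≤ u x) (huv : ∀ᵐ x, u x ≤ |f x| + |g x|)
    (hvb : ∀ᵐ x, |v x| ≤ |f x| + |g x|) :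
    Integrable (fun x => (|f x| + |g x|) ^ m) ∧
      (∀ᵐ x, ‖u x ^ (m - 1) * v x‖ ≤ (|f x| + |g x|) ^ m) ∧
      Integrable (fun x => u x ^ (m - 1) * v x) := by
  have hI : Integrable (fun x => (|f x| + |g x|) ^ m) := by
    have := (hf.abs.add hg.abs).integrable_norm_rpow (by simp; linarith) ENNReal.ofReal_ne_top
    rw [ENNReal.toReal_ofReal (by linarith)] at this
    refine this.congr (ae_of_all _ fun x => ?_)
    simp only [Pi.add_apply, Pi.abs_apply]
    rw [Real.norm_of_nonneg (by positivity)]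
  have hb : ∀ᵐ x, ‖u x ^ (m - 1) * v x‖ ≤ (|f x| + |g x|) ^ m := by
    filter_upwards [hu0, huv, hvb] with x h0 h1 h2
    rw [norm_mul, Real.norm_of_nonneg (Real.rpow_nonneg h0 _), Real.norm_eq_abs]
    have hs : 0 ≤ |f x| + |g x| := by positivity
    have e : (|f x| + |g x|) ^ m = (|f x| + |g x|) ^ (m - 1) * (|f x| + |g x|) := by
      rw [← Real.rpow_add_one' hs (by linarith), sub_add_cancel]
    rw [e]
    gcongr
    linarith
  refine ⟨hI, hb, hI.mono' ?_ hb⟩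
  exact ((hu.aemeasurable.pow_const _).aestronglyMeasurable).mul hv

lemma integrable_rpow_of_memLp {m : ℝ} (hm : 2 < m) {f : Euc d → ℝ}
    (hf : MemLp f (ENNReal.ofReal m) volume) (h0 : ∀ᵐ x, 0 ≤ f x) :
    Integrable fun x => f x ^ m := by
  have := hf.integrable_norm_rpow (by simp; linarith) ENNReal.ofReal_ne_top
  rw [ENNReal.toReal_ofReal (by linarith)] at this
  refine this.congr ?_
  filter_upwards [h0] with x hx
  rw [Real.norm_of_nonneg hx]

/-- First order optimality of a minimizer along segments in the admissible class. -/
lemma first_variation {ε m M : ℝ} (hε : 0 < ε) (hm : 2 < m) (hW : AttractiveKernel W)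
    {ρ η : Euc d → ℝ} (hρ : IsGlobalMinimizer ε m M W ρ) (hη : η ∈ admissible d m M) :
    0 ≤ ε * m / (m - 1) * (∫ x, ρ x ^ (m - 1) * (η x - ρ x)) +
      ∫ x, (η x - ρ x) * conv W ρ x := by
  obtain ⟨h1, h2, h3, h4⟩ := hρ.1
  obtain ⟨k1, k2, k3, k4⟩ := hη
  have hm1 : 0 < m - 1 := by linarith
  have hρ2 := memLp_two hm h1 h2
  have hη2 := memLp_two hm k1 k2
  have hu2 : MemLp (fun x => η x - ρ x) 2 volume := hη2.sub hρ2
  rw [integral_mul_conv hW.integrable hu2 hρ2]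
  set u : Euc d → ℝ := fun x => η x - ρ x with hu
  have hum : AEStronglyMeasurable u volume := hu2.aestronglyMeasurable
  have hbase : ∀ t : ℝ, 0 ≤ t → t ≤ 1 →
      (∀ᵐ x, 0 ≤ ρ x + t * u x) ∧ (∀ᵐ x, ρ x + t * u x ≤ |ρ x| + |η x|) := by
    intro t ht0 ht1
    refine ⟨(admissible_segment ht0 ht1 hρ.1 ⟨k1, k2, k3, k4⟩).2.2.1, ?_⟩
    filter_upwards [h3, k3] with x hx kx
    rw [abs_of_nonneg hx, abs_of_nonneg kx]
    simp only [hu]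
    nlinarith [mul_nonneg ht0 hx, mul_nonneg (sub_nonneg.2 ht1) kx]
  have hub : ∀ᵐ x, |u x| ≤ |ρ x| + |η x| :=
    ae_of_all _ fun x => (abs_sub _ _).trans_eq (add_comm _ _)
  have hint : ∀ t : ℝ, 0 ≤ t → t ≤ 1 →
      Integrable (fun x => (|ρ x| + |η x|) ^ m) ∧
      (∀ᵐ x, ‖(ρ x + t * u x) ^ (m - 1) * u x‖ ≤ (|ρ x| + |η x|) ^ m) ∧
      Integrable (fun x => (ρ x + t * u x) ^ (m - 1) * u x) := fun t ht0 ht1 =>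
    integrable_rpow_mul hm h2 k2 (h1.aestronglyMeasurable.add (hum.const_mul t)) hum
      (hbase t ht0 ht1).1 (hbase t ht0 ht1).2 hub
  have hineq : ∀ t : ℝ, 0 < t → t ≤ 1 →
      0 ≤ ε * m / (m - 1) * (∫ x, (ρ x + t * u x) ^ (m - 1) * u x) + interaction W u ρ +
        t / 2 * interaction W u u := by
    intro t ht0 ht1
    have hadm := admissible_segment ht0.le ht1 hρ.1 ⟨k1, k2, k3, k4⟩
    have hE := hρ.2 _ hadm
    have hs2 := memLp_two hm hadm.1 hadm.2.1
    unfold energy at hE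
    rw [integral_mul_conv hW.integrable hρ2 hρ2, integral_mul_conv hW.integrable hs2 hs2,
      interaction_add_smul hW hρ2 hu2] at hE
    -- The tangent is taken at the perturbed density, so convexity bounds the increment from above
    -- without differentiating under the integral; the limit `t → 0` is taken only after division by
    -- `t`.
    have hpow : ∫ x, (ρ x + t * u x) ^ m ≤ (∫ x, ρ x ^ m) +
        m * t * ∫ x, (ρ x + t * u x) ^ (m - 1) * u x := by
      have i1 := integrable_rpow_of_memLp hm h2 h3
      have i2 := (hint t ht0.le ht1).2.2.const_mul (m * t)
      rw [← integral_const_mul, ← integral_add i1 i2]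
      refine integral_mono_ae (integrable_rpow_of_memLp hm hadm.2.1 hadm.2.2.1) (i1.add i2) ?_
      filter_upwards [h3, (hbase t ht0.le ht1).1] with x hx hx'
      have := rpow_tangent_le (m := m) (by linarith) hx hx'
      linarith
    have hc : 0 < ε / (m - 1) := by positivity
    have h5 := mul_le_mul_of_nonneg_left hpow hc.le
    have h6 : 0 ≤ t * (ε * m / (m - 1) * (∫ x, (ρ x + t * u x) ^ (m - 1) * u x) +
        interaction W u ρ + t / 2 * interaction W u u) := by
      have e : ε / (m - 1) * ((∫ x, ρ x ^ m) +
        m * t * ∫ x, (ρ x + t * u x) ^ (m - 1) * u x) = ε / (m - 1) * (∫ x, ρ x ^ m) +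
          t * (ε * m / (m - 1) * ∫ x, (ρ x + t * u x) ^ (m - 1) * u x) := by
        ring
      rw [e] at h5
      linarith
    exact nonneg_of_mul_nonneg_right h6 ht0
  have hlim : Tendsto (fun t : ℝ => ∫ x, (ρ x + t * u x) ^ (m - 1) * u x) (𝓝[>] 0)
      (𝓝 (∫ x, ρ x ^ (m - 1) * u x)) := by
    have hev : ∀ᶠ t : ℝ in 𝓝[>] 0, 0 ≤ t ∧ t ≤ 1 := by
      filter_upwards [Ioc_mem_nhdsGT (zero_lt_one' ℝ)] with t ht using ⟨ht.1.le, ht.2⟩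
    refine tendsto_integral_filter_of_dominated_convergence (fun x => (|ρ x| + |η x|) ^ m)
      ?_ ?_ (hint 0 le_rfl zero_le_one).1 ?_
    · filter_upwards [hev] with t ht using (hint t ht.1 ht.2).2.2.aestronglyMeasurable
    · filter_upwards [hev] with t ht using (hint t ht.1 ht.2).2.1
    · refine ae_of_all _ fun x => ?_
      have hcont : ContinuousAt (fun t : ℝ => (ρ x + t * u x) ^ (m - 1) * u x) 0 := by
        refine ContinuousAt.mul (ContinuousAt.rpow_const (by fun_prop) (Or.inr hm1.le))
          continuousAt_const
      have := hcont.tendsto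
      simp only [zero_mul, add_zero] at this
      exact this.mono_left nhdsWithin_le_nhds
  have hlim2 : Tendsto (fun t : ℝ => ε * m / (m - 1) *
      (∫ x, (ρ x + t * u x) ^ (m - 1) * u x) + interaction W u ρ + t / 2 * interaction W u u)
      (𝓝[>] 0) (𝓝 (ε * m / (m - 1) * (∫ x, ρ x ^ (m - 1) * u x) + interaction W u ρ +
        0 / 2 * interaction W u u)) := by
    refine ((hlim.const_mul _).add tendsto_const_nhds).add ?_
    exact ((tendsto_id.div_const 2).mul_const _).mono_left nhdsWithin_le_nhds
  have := ge_of_tendsto hlim2 (b := 0) (by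
    filter_upwards [Ioc_mem_nhdsGT (zero_lt_one' ℝ)] with t ht using hineq t ht.1 ht.2)
  simpa using this

end

/-! ### Euler–Lagrange conditions, boundedness and continuity of minimizers -/

section

variable {d : ℕ} {W : Euc d → ℝ}

lemma indicator_admissible {m M : ℝ} (hM : 0 < M) {s : Set (Euc d)} (hs : MeasurableSet s)
    (hs0 : volume s ≠ 0) (hst : volume s ≠ ⊤) :
    s.indicator (fun _ => M / volume.real s) ∈ admissible d m M := by
  have hpos : 0 < volume.real s := ENNReal.toReal_pos hs0 hst
  refine ⟨memLp_indicator_const _ hs _ (Or.inr hst), memLp_indicator_const _ hs _ (Or.inr hst),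
    ae_of_all _ fun x => indicator_nonneg (fun _ _ => by positivity) _, ?_⟩
  rw [integral_indicator_const _ hs, smul_eq_mul]
  field_simp

/-- The Euler–Lagrange conditions for a minimizer. -/
lemma euler_lagrange {ε m M : ℝ} (hε : 0 < ε) (hm : 2 < m) (hM : 0 < M)
    (hW : AttractiveKernel W) {ρ : Euc d → ℝ} (hρ : IsGlobalMinimizer ε m M W ρ) :
    ∃ l : ℝ, ∀ᵐ x, l ≤ ε * m / (m - 1) * ρ x ^ (m - 1) + conv W ρ x ∧
      (ρ x ≠ 0 → ε * m / (m - 1) * ρ x ^ (m - 1) + conv W ρ x = l) := by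
  obtain ⟨h1, h2, h3, h4⟩ := hρ.1
  set c := ε * m / (m - 1) with hc
  set ψ : Euc d → ℝ := fun x => c * ρ x ^ (m - 1) + conv W ρ x with hψ
  have hρ2 := memLp_two hm h1 h2
  have hI1 : ∀ η ∈ admissible d m M, Integrable (fun x => ρ x ^ (m - 1) * η x) := by
    intro η hη
    refine (integrable_rpow_mul hm h2 hη.2.1 h1.aestronglyMeasurable
      hη.1.aestronglyMeasurable h3 ?_ ?_).2.2
    · exact ae_of_all _ fun x => by linarith [le_abs_self (ρ x), abs_nonneg (η x)]
    · exact ae_of_all _ fun x => by linarith [abs_nonneg (ρ x)]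
  have hI2 : ∀ η ∈ admissible d m M, Integrable (fun x => η x * conv W ρ x) := fun η hη =>
    integrable_mul_conv hW.integrable (memLp_two hm hη.1 hη.2.1) hρ2
  have hIψ : ∀ η ∈ admissible d m M, Integrable (fun x => ψ x * η x) := fun η hη =>
    (((hI1 η hη).const_mul c).add (hI2 η hη)).congr (ae_of_all _ fun x => by
      simp only [hψ, Pi.add_apply]; ring)
  have hIψe : ∀ η ∈ admissible d m M, ∫ x, ψ x * η x =
      c * (∫ x, ρ x ^ (m - 1) * η x) + ∫ x, η x * conv W ρ x := by
    intro η hη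
    rw [← integral_const_mul, ← integral_add ((hI1 η hη).const_mul c) (hI2 η hη)]
    exact integral_congr_ae (ae_of_all _ fun x => by simp only [hψ]; ring)
  have hvar : ∀ η ∈ admissible d m M, ∫ x, ψ x * ρ x ≤ ∫ x, ψ x * η x := by
    intro η hη
    have h := first_variation hε hm hW hρ hη
    simp only [mul_sub, sub_mul] at h
    rw [integral_sub (hI1 η hη) (hI1 ρ hρ.1), integral_sub (hI2 η hη) (hI2 ρ hρ.1)] at h
    rw [hIψe η hη, hIψe ρ hρ.1]
    linarith
  -- The multiplier is the mean of `ψ` with respect to `ρ`. Testing minimality against the uniform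
  -- density of mass `M` on a set `s` shows that the average of `ψ` over `s` is at least `l`.
  set l := (∫ x, ψ x * ρ x) / M with hl
  have hset : ∀ s : Set (Euc d), MeasurableSet s → volume s < ⊤ →
      IntegrableOn (fun x => ψ x - l) s volume ∧ 0 ≤ ∫ x in s, (ψ x - l) := by
    intro s hs hst
    by_cases hs0 : volume s = 0
    · rw [IntegrableOn, Measure.restrict_eq_zero.2 hs0]
      simp
    have hpos : 0 < volume.real s := ENNReal.toReal_pos hs0 hst.ne
    have hadm := indicator_admissible (m := m) hM hs hs0 hst.ne
    have e : ∀ x, ψ x * s.indicator (fun _ => M / volume.real s) x =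
        s.indicator (fun x => ψ x * (M / volume.real s)) x := by
      intro x
      by_cases hx : x ∈ s <;> simp [hx]
    have i1 := hIψ _ hadm
    have i2 := hvar _ hadm
    simp only [e] at i1 i2
    rw [integrable_indicator_iff hs] at i1
    rw [integral_indicator hs, integral_mul_const] at i2
    have i3 : IntegrableOn ψ s := by
      refine (i1.mul_const (volume.real s / M)).congr (ae_of_all _ fun x => ?_)
      field_simp
    have i4 : IntegrableOn (fun _ : Euc d => l) s := integrableOn_const hst.ne
    refine ⟨i3.sub i4, ?_⟩
    rw [integral_sub i3 i4, setIntegral_const, smul_eq_mul]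
    have e2 : ∫ x, ψ x * ρ x = l * M := by rw [hl]; field_simp
    rw [e2] at i2
    have : volume.real s / M * (l * M) ≤ volume.real s / M *
      ((∫ x in s, ψ x) * (M / volume.real s)) := by gcongr
    have e3 : volume.real s / M * ((∫ x in s, ψ x) * (M / volume.real s)) = ∫ x in s, ψ x := by
      field_simp
    have e4 : volume.real s / M * (l * M) = volume.real s * l := by field_simp
    linarith
  have hge : 0 ≤ᵐ[volume] fun x => ψ x - l :=
    ae_nonneg_of_forall_setIntegral_nonneg_of_sigmaFinite (fun s hs hst => (hset s hs hst).1)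
      fun s hs hst => (hset s hs hst).2
  have hρi : Integrable ρ := memLp_one_iff_integrable.1 h1
  -- By the choice of `l` this nonnegative function has integral zero.
  have hprod : (fun x => (ψ x - l) * ρ x) =ᵐ[volume] 0 := by
    have hi : Integrable (fun x => (ψ x - l) * ρ x) :=
      ((hIψ ρ hρ.1).sub (hρi.const_mul l)).congr (ae_of_all _ fun x => by
        simp only [Pi.sub_apply]; ring)
    refine (integral_eq_zero_iff_of_nonneg_ae ?_ hi).1 ?_
    · filter_upwards [hge, h3] with x hx hx'
      exact mul_nonneg hx hx'
    · simp only [sub_mul]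
      rw [integral_sub (hIψ ρ hρ.1) (hρi.const_mul l), integral_const_mul, h4, hl]
      field_simp
      ring
  refine ⟨l, ?_⟩
  filter_upwards [hge, hprod] with x hx hx'
  refine ⟨sub_nonneg.1 hx, fun h0 => ?_⟩
  exact sub_eq_zero.1 ((mul_eq_zero.1 hx').resolve_right h0)

/-- Truncating an integrable function from below changes it little in `L¹`. -/
lemma exists_truncation (hW : Integrable W) {η : ℝ} (hη : 0 < η) :
    ∃ k : ℝ, 0 ≤ k ∧ Integrable (fun x => max (W x) (-k) - W x) ∧
      ∫ x, (max (W x) (-k) - W x) < η := by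
  have hm : ∀ k : ℕ, AEStronglyMeasurable (fun x => max (W x) (-(k : ℝ)) - W x) volume := fun k =>
    (hW.aestronglyMeasurable.sup aestronglyMeasurable_const).sub hW.aestronglyMeasurable
  have hb : ∀ k : ℕ, ∀ x, ‖max (W x) (-(k : ℝ)) - W x‖ ≤ |W x| := by
    intro k x
    have hk : (0 : ℝ) ≤ k := k.cast_nonneg
    rw [Real.norm_eq_abs, abs_of_nonneg (sub_nonneg.2 (le_max_left _ _))]
    rcases le_total (W x) (-k) with h | h
    · rw [max_eq_right h, abs_of_nonpos (by linarith)]; linarith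
    · rw [max_eq_left h, sub_self]; exact abs_nonneg _
  have hlim : Tendsto (fun k : ℕ => ∫ x, (max (W x) (-(k : ℝ)) - W x)) atTop
      (𝓝 (∫ _ : Euc d, (0 : ℝ))) := by
    refine tendsto_integral_of_dominated_convergence (fun x => |W x|) hm hW.abs
      (fun k => ae_of_all _ (hb k)) (ae_of_all _ fun x => ?_)
    obtain ⟨n, hn⟩ := exists_nat_ge (-W x)
    refine tendsto_const_nhds.congr' ?_
    filter_upwards [eventually_ge_atTop n] with k hk
    have : (n : ℝ) ≤ k := by exact_mod_cast hk
    rw [max_eq_left (by linarith), sub_self]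
  rw [integral_zero] at hlim
  obtain ⟨k, hk⟩ := (hlim.eventually_lt_const hη).exists
  exact ⟨k, k.cast_nonneg, hW.abs.mono' (hm k) (ae_of_all _ (hb k)), hk⟩

lemma ae_integrable_conv {a ρ : Euc d → ℝ} (ha : Integrable a) (hρ : Integrable ρ) :
    ∀ᵐ x, Integrable fun y => a (x - y) * ρ y := by
  have := (hρ.convolution_integrand (ContinuousLinearMap.mul ℝ ℝ) ha).prod_right_ae
  filter_upwards [this] with x hx
  refine hx.congr (ae_of_all _ fun y => ?_)
  simp [mul_comm]

lemma conv_eq_convolution (a ρ : Euc d → ℝ) :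
    conv a ρ = convolution ρ a (ContinuousLinearMap.mul ℝ ℝ) volume := by
  funext x
  simp [conv, convolution, mul_comm]

/-- A nonnegative integrable function which is bounded by a constant plus its convolution with a
nonnegative kernel of mass at most `1/2` is bounded. -/
lemma ae_le_of_le_add_conv {a ρ : Euc d → ℝ} {C : ℝ} (ha : Integrable a) (ha0 : ∀ x, 0 ≤ a x)
    (ha1 : ∫ x, a x ≤ 1 / 2) (hρ : Integrable ρ) (hC : 0 ≤ C)
    (h : ∀ᵐ x, ρ x ≤ C + conv a ρ x) : ∀ᵐ x, ρ x ≤ 2 * C := by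
  -- The excess over `2 * C` satisfies `f ≤ a * f` (convolution), because the constant part `2 * C`
  -- contributes at most `C` to `a * ρ`. Integrating gives `∫ f ≤ (1/2) ∫ f`, so `f` vanishes.
  set f : Euc d → ℝ := fun x => max (ρ x) (2 * C) - 2 * C with hf
  have hf0 : ∀ x, 0 ≤ f x := fun x => sub_nonneg.2 (le_max_right _ _)
  have hρf : ∀ x, ρ x ≤ 2 * C + f x := fun x => by
    simp only [hf]; linarith [le_max_left (ρ x) (2 * C)]
  have hfi : Integrable f := by
    refine hρ.abs.mono' ((hρ.aestronglyMeasurable.sup aestronglyMeasurable_const).sub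
      aestronglyMeasurable_const) (ae_of_all _ fun x => ?_)
    rw [Real.norm_of_nonneg (hf0 x)]
    simp only [hf]
    rcases le_total (ρ x) (2 * C) with h' | h'
    · rw [max_eq_right h', sub_self]; exact abs_nonneg _
    · rw [max_eq_left h']; linarith [le_abs_self (ρ x)]
  have hconv0 : ∀ x, 0 ≤ conv a f x := fun x =>
    integral_nonneg fun y => mul_nonneg (ha0 _) (hf0 _)
  have hle : ∀ᵐ x, f x ≤ conv a f x := by
    filter_upwards [h, ae_integrable_conv ha hρ, ae_integrable_conv ha hfi] with x hx h1 h2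
    have i0 : Integrable fun y => a (x - y) := ha.comp_sub_left x
    have h3 : conv a ρ x ≤ 2 * C * (∫ y, a y) + conv a f x := by
      rw [← integral_sub_left_eq_self a volume x, ← integral_const_mul, conv, conv,
        ← integral_add (i0.const_mul _) h2]
      refine integral_mono h1 ((i0.const_mul _).add h2) fun y => ?_
      nlinarith [mul_le_mul_of_nonneg_left (hρf y) (ha0 (x - y))]
    have h4 : ρ x - 2 * C ≤ conv a f x := by nlinarith
    simp only [hf]
    rcases le_total (ρ x) (2 * C) with h' | h'
    · rw [max_eq_right h', sub_self]; exact hconv0 x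
    · rw [max_eq_left h']; exact h4
  have hint : ∫ x, f x ≤ (∫ x, f x) * ∫ x, a x := by
    have e := integral_convolution (ContinuousLinearMap.mul ℝ ℝ) hfi ha
    have i := hfi.integrable_convolution (ContinuousLinearMap.mul ℝ ℝ) ha
    rw [← conv_eq_convolution] at e i
    rw [ContinuousLinearMap.mul_apply'] at e
    rw [← e]
    exact integral_mono_ae hfi i hle
  have hz : ∫ x, f x = 0 := by
    have : 0 ≤ ∫ x, f x := integral_nonneg fun x => hf0 x
    nlinarith
  filter_upwards [(integral_eq_zero_iff_of_nonneg hf0 hfi).1 hz] with x hx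
  have := hρf x
  simp only [Pi.zero_apply] at hx
  linarith

/-- Minimizers are bounded. -/
lemma exists_ae_bound {c m l : ℝ} (hc : 0 < c) (hm : 2 < m) (hW : AttractiveKernel W)
    {ρ : Euc d → ℝ} (hρ : Integrable ρ) (hρ0 : ∀ᵐ x, 0 ≤ ρ x)
    (h : ∀ᵐ x, ρ x ≠ 0 → c * ρ x ^ (m - 1) + conv W ρ x = l) : ∃ B, ∀ᵐ x, ρ x ≤ B := by
  -- Split `W ≥ -k - N` with a singular part `N` of mass below `c / 2`: after division by `c`, the
  -- kernel `N / c` has mass at most `1/2`, and `-k` contributes the constant `k * I`.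
  obtain ⟨k, hk, hNi, hN⟩ := exists_truncation hW.integrable (half_pos hc)
  set N : Euc d → ℝ := fun x => max (W x) (-k) - W x with hNdef
  have hN0 : ∀ x, 0 ≤ N x := fun x => sub_nonneg.2 (le_max_left _ _)
  set I := ∫ x, ρ x with hI
  have hI0 : 0 ≤ I := integral_nonneg_of_ae hρ0
  refine ⟨2 * (1 + (|l| + k * I) / c), ?_⟩
  refine ae_le_of_le_add_conv (a := fun x => c⁻¹ * N x) (hNi.const_mul _)
    (fun x => mul_nonneg (by positivity) (hN0 x)) ?_ hρ (by positivity) ?_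
  · rw [integral_const_mul]
    calc c⁻¹ * ∫ x, N x ≤ c⁻¹ * (c / 2) := by gcongr
      _ = 1 / 2 := by field_simp
  · filter_upwards [h, hρ0, ae_integrable_conv hW.integrable hρ, ae_integrable_conv hNi hρ]
      with x hx hx0 h1 h2
    have e : conv (fun x => c⁻¹ * N x) ρ x = c⁻¹ * conv N ρ x := by
      simp only [conv, mul_assoc, integral_const_mul]
    have hcN : 0 ≤ conv N ρ x := integral_nonneg_of_ae (by
      filter_upwards [hρ0] with y hy using mul_nonneg (hN0 _) hy)
    rw [e]
    by_cases hz : ρ x = 0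
    · rw [hz]; positivity
    have hV : -(k * I) - conv N ρ x ≤ conv W ρ x := by
      rw [hI, neg_mul_eq_neg_mul, ← integral_const_mul, conv, conv,
        ← integral_sub (hρ.const_mul (-k)) h2]
      refine integral_mono_ae ((hρ.const_mul (-k)).sub h2) h1 ?_
      filter_upwards [hρ0] with y hy
      simp only [hNdef]
      nlinarith [mul_le_mul_of_nonneg_right (le_max_right (W (x - y)) (-k)) hy]
    have hpow : ρ x ≤ 1 + ρ x ^ (m - 1) := by
      rcases le_total (ρ x) 1 with h' | h'
      · have := Real.rpow_nonneg hx0 (m - 1); linarith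
      · have := Real.rpow_le_rpow_of_exponent_le h' (show (1 : ℝ) ≤ m - 1 by linarith)
        rw [Real.rpow_one] at this; linarith
    have hfin : ρ x ^ (m - 1) ≤ (|l| + k * I) / c + c⁻¹ * conv N ρ x := by
      have : ρ x ^ (m - 1) = c⁻¹ * (l - conv W ρ x) := by
        rw [← hx hz]; field_simp; ring
      rw [this, div_eq_inv_mul, ← mul_add]
      gcongr
      linarith [le_abs_self l]
    linarith

lemma integrable_kernel_mul {a ρ : Euc d → ℝ} (ha : Integrable a) (hρ : Integrable ρ) {B : ℝ}
    (hB : ∀ᵐ x, |ρ x| ≤ B) (x : Euc d) : Integrable fun y => a (x - y) * ρ y :=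
  (ha.comp_sub_left x).mul_bdd hρ.aestronglyMeasurable (by simpa using hB)

lemma ae_sub_ne_zero (hd : 1 ≤ d) (x : Euc d) : ∀ᵐ y, x - y ≠ 0 := by
  have : Nonempty (Fin d) := ⟨⟨0, hd⟩⟩
  filter_upwards [compl_mem_ae_iff.2 (measure_singleton x)] with y hy
  exact sub_ne_zero.2 fun h => hy h.symm

/-- The potential generated by a bounded density is continuous. -/
lemma continuous_conv (hd : 1 ≤ d) (hW : AttractiveKernel W) {ρ : Euc d → ℝ} (hρ : Integrable ρ)
    {B : ℝ} (hB : ∀ᵐ x, |ρ x| ≤ B) : Continuous (conv W ρ) := by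
  have hB0 : 0 ≤ |B| := abs_nonneg B
  -- The potentials of the truncated kernels are continuous by dominated convergence. They
  -- approximate `conv W ρ` uniformly, with error at most the `L¹` norm of the removed part times
  -- the bound on `ρ`.
  refine continuous_of_uniform_approx_of_continuous fun u hu => ?_
  obtain ⟨η, hη, hu⟩ := Metric.mem_uniformity_dist.1 hu
  obtain ⟨k, hk, hNi, hN⟩ := exists_truncation hW.integrable (η := η / (|B| + 1)) (by positivity)
  set N : Euc d → ℝ := fun x => max (W x) (-k) - W x with hNdef
  have hN0 : ∀ x, 0 ≤ N x := fun x => sub_nonneg.2 (le_max_left _ _)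
  have hsum : ∀ x, conv (fun z => max (W z) (-k)) ρ x = conv N ρ x + conv W ρ x := by
    intro x
    rw [conv, conv, conv, ← integral_add (integrable_kernel_mul hNi hρ hB x)
      (integrable_kernel_mul hW.integrable hρ hB x)]
    refine integral_congr_ae (ae_of_all _ fun y => ?_)
    simp only [hNdef]; ring
  refine ⟨conv (fun z => max (W z) (-k)) ρ, ?_, fun x => hu ?_⟩
  · have hkm : AEStronglyMeasurable (fun z => max (W z) (-k)) volume :=
      hW.integrable.aestronglyMeasurable.sup aestronglyMeasurable_const
    rw [continuous_iff_continuousAt]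
    intro x₀
    refine continuousAt_of_dominated (bound := fun y => k * |ρ y|) ?_ ?_ (hρ.abs.const_mul k) ?_
    · refine Eventually.of_forall fun x => ?_
      exact (hkm.comp_quasiMeasurePreserving
        (quasiMeasurePreserving_sub_left volume x)).mul hρ.aestronglyMeasurable
    · refine Eventually.of_forall fun x => ?_
      filter_upwards [ae_sub_ne_zero hd x] with y hy
      rw [norm_mul, Real.norm_eq_abs, Real.norm_eq_abs]
      gcongr
      rw [abs_le]
      exact ⟨le_max_right _ _, max_le ((hW.nonpos hy).trans hk) (by linarith)⟩
    · filter_upwards [ae_sub_ne_zero hd x₀] with y hy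
      have h1 : ContinuousAt (fun x => W (x - y)) x₀ :=
        ContinuousAt.comp (f := fun x => x - y) (hW.continuousAt _ hy) (by fun_prop)
      exact (h1.max continuousAt_const).mul continuousAt_const
  · rw [hsum, Real.dist_eq]
    have e : conv W ρ x - (conv N ρ x + conv W ρ x) = - conv N ρ x := by ring
    rw [e, abs_neg]
    have h1 : |conv N ρ x| ≤ (∫ y, N y) * |B| := by
      rw [← integral_sub_left_eq_self N volume x, ← integral_mul_const, ← Real.norm_eq_abs]
      refine norm_integral_le_of_norm_le ((hNi.comp_sub_left x).mul_const _) ?_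
      filter_upwards [hB] with y hy
      rw [norm_mul, Real.norm_of_nonneg (hN0 _), Real.norm_eq_abs]
      exact mul_le_mul_of_nonneg_left (hy.trans (le_abs_self B)) (hN0 _)
    have h2 : (∫ y, N y) * (|B| + 1) < η := by
      rwa [lt_div_iff₀ (by positivity)] at hN
    have h3 : 0 ≤ ∫ y, N y := integral_nonneg hN0
    linarith

/-- A continuous density in equilibrium with the potential it generates. -/
structure IsEquilibrium (W f : Euc d → ℝ) (l : ℝ) : Prop where
  continuous : Continuous f
  integrable : Integrable f
  nonneg : ∀ x, 0 ≤ f x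
  integrable_kernel : ∀ x, Integrable fun y => W (x - y) * f y
  continuous_conv : Continuous (conv W f)
  pos_iff : ∀ x, 0 < f x ↔ conv W f x < l
  lt_of_conv_lt : ∀ x y, conv W f x < l → conv W f x < conv W f y → f y < f x

/-- Every minimizer has a continuous representative in equilibrium. -/
lemma exists_equilibrium {ε m M : ℝ} (hd : 1 ≤ d) (hε : 0 < ε) (hm : 2 < m) (hM : 0 < M)
    (hW : AttractiveKernel W) {ρ : Euc d → ℝ} (hρ : IsGlobalMinimizer ε m M W ρ) :
    ∃ f l, IsEquilibrium W f l ∧ ρ =ᵐ[volume] f := by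
  obtain ⟨l, hEL⟩ := euler_lagrange hε hm hM hW hρ
  obtain ⟨h1, -, h3, -⟩ := hρ.1
  have hρi : Integrable ρ := memLp_one_iff_integrable.1 h1
  have hm1 : 0 < m - 1 := by linarith
  set c := ε * m / (m - 1) with hcdef
  have hc : 0 < c := by positivity
  obtain ⟨B, hB⟩ := exists_ae_bound hc hm hW hρi h3 (hEL.mono fun x hx => hx.2)
  have hB' : ∀ᵐ x, |ρ x| ≤ B := by
    filter_upwards [hB, h3] with x hx hx'
    rwa [abs_of_nonneg hx']
  have hVc := continuous_conv hd hW hρi hB'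
  -- The Euler–Lagrange conditions solved for the density; `f` inherits the continuity of the
  -- potential, which is unchanged on passing from `ρ` to `f`.
  set f : Euc d → ℝ := fun x => (max (l - conv W ρ x) 0 / c) ^ (m - 1)⁻¹ with hf
  have hρf : ρ =ᵐ[volume] f := by
    filter_upwards [hEL, h3] with x hx hx0
    simp only [hf]
    by_cases hz : ρ x = 0
    · have := hx.1
      rw [hz, Real.zero_rpow hm1.ne', mul_zero, zero_add] at this
      rw [hz, max_eq_right (by linarith), zero_div, Real.zero_rpow (inv_ne_zero hm1.ne')]
    · have e : l - conv W ρ x = c * ρ x ^ (m - 1) := by rw [← hx.2 hz]; ring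
      have hp : 0 ≤ ρ x ^ (m - 1) := Real.rpow_nonneg hx0 _
      rw [e, max_eq_left (by positivity), mul_div_cancel_left₀ _ hc.ne',
        Real.rpow_rpow_inv hx0 hm1.ne']
  have hcf := conv_congr (W := W) hρf
  have hbase : ∀ x, 0 ≤ max (l - conv W ρ x) 0 / c := fun x => by positivity
  have hpos : ∀ x, conv W ρ x < l → 0 < max (l - conv W ρ x) 0 / c := fun x hx =>
    div_pos (lt_max_of_lt_left (by linarith)) hc
  refine ⟨f, l, ⟨?_, hρi.congr hρf, fun x => Real.rpow_nonneg (hbase x) _, fun x => ?_,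
    hcf ▸ hVc, fun x => ?_, fun x y hx hxy => ?_⟩, hρf⟩
  · exact (((continuous_const.sub hVc).max continuous_const).div_const _).rpow_const
      fun x => Or.inr (by positivity)
  · refine (integrable_kernel_mul hW.integrable hρi hB' x).congr ?_
    filter_upwards [hρf] with y hy
    rw [hy]
  · rw [← hcf]
    refine ⟨fun h => ?_, fun h => Real.rpow_pos_of_pos (hpos x h) _⟩
    by_contra! hle
    simp only [hf] at h
    rw [max_eq_right (by linarith), zero_div, Real.zero_rpow (inv_ne_zero hm1.ne')] at h
    exact lt_irrefl _ h
  · rw [← hcf] at hx hxy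
    refine Real.rpow_lt_rpow (hbase y) ?_ (by positivity)
    refine div_lt_div_of_pos_right ?_ hc
    rw [max_eq_left (a := l - conv W ρ x) (by linarith)]
    exact max_lt (by linarith) (by linarith)

end

/-! ### Reflections and polarization -/

section

variable {d : ℕ} {W : Euc d → ℝ} {e : Euc d} {c : ℝ}

/-- The signed height of `x` over the hyperplane `⟪e, x⟫ = c`. -/
noncomputable def height (e : Euc d) (c : ℝ) (x : Euc d) : ℝ := inner ℝ e x - c

/-- The reflection in the hyperplane `⟪e, x⟫ = c`, for a unit vector `e`. -/
noncomputable def refl (e : Euc d) (c : ℝ) (x : Euc d) : Euc d := x - (2 * height e c x) • e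

@[fun_prop]
lemma continuous_height : Continuous (height e c) := by unfold height; fun_prop

@[fun_prop]
lemma continuous_refl : Continuous (refl e c) := by unfold refl; fun_prop

lemma height_refl (he : ‖e‖ = 1) (x : Euc d) : height e c (refl e c x) = - height e c x := by
  have h : inner ℝ e e = (1 : ℝ) := by rw [real_inner_self_eq_norm_sq, he, one_pow]
  unfold refl
  rw [height, inner_sub_right, inner_smul_right, h, height]; ring

lemma refl_refl (he : ‖e‖ = 1) (x : Euc d) : refl e c (refl e c x) = x := by
  rw [refl, height_refl he, refl]; module

lemma refl_of_height_eq_zero {x : Euc d} (h : height e c x = 0) : refl e c x = x := by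
  simp [refl, h]

/-- All comparisons of distances below reduce to the sign of this product of heights. -/
lemma norm_sub_refl_sq (he : ‖e‖ = 1) (x y : Euc d) :
    ‖x - refl e c y‖ ^ 2 = ‖x - y‖ ^ 2 + 4 * (height e c x * height e c y) := by
  have : x - refl e c y = (x - y) + (2 * height e c y) • e := by unfold refl; module
  rw [this, norm_add_sq_real, norm_smul, he, inner_smul_right, real_inner_comm, inner_sub_right]
  simp only [height, mul_one, Real.norm_eq_abs, sq_abs]
  ring

lemma norm_refl_sub (he : ‖e‖ = 1) (x y : Euc d) : ‖refl e c x - y‖ = ‖x - refl e c y‖ := by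
  rw [← sq_eq_sq₀ (norm_nonneg _) (norm_nonneg _), norm_sub_refl_sq he, norm_sub_rev,
    norm_sub_refl_sq he, norm_sub_rev, mul_comm (height e c x)]

lemma norm_refl_sub_refl (he : ‖e‖ = 1) (x y : Euc d) :
    ‖refl e c x - refl e c y‖ = ‖x - y‖ := by
  rw [norm_refl_sub he, refl_refl he]

lemma norm_refl_sub_self (he : ‖e‖ = 1) (x : Euc d) : ‖refl e c x - x‖ = 2 * |height e c x| := by
  have : refl e c x - x = -((2 * height e c x) • e) := by unfold refl; module
  rw [this, norm_neg, norm_smul, he, mul_one, Real.norm_eq_abs, abs_mul, abs_two]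

/-- The reflection as a measurable equivalence. -/
noncomputable def reflEquiv (e : Euc d) (c : ℝ) (he : ‖e‖ = 1) : Euc d ≃ᵐ Euc d where
  toFun := refl e c
  invFun := refl e c
  left_inv := refl_refl he
  right_inv := refl_refl he
  measurable_toFun := continuous_refl.measurable
  measurable_invFun := continuous_refl.measurable

lemma measurePreserving_refl (he : ‖e‖ = 1) :
    MeasurePreserving (refl e c) volume volume := by
  have h1 : refl e c = (fun x => x + (2 * c) • e) ∘ (Submodule.reflection (ℝ ∙ e)ᗮ) := by
    funext x
    simp only [Function.comp, Submodule.reflection_orthogonal_apply,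
      Submodule.reflection_singleton_apply, he, refl, height]
    simp
    module
  rw [h1]
  exact (measurePreserving_add_right volume _).comp (LinearIsometryEquiv.measurePreserving _)

lemma measurePreserving_reflEquiv (he : ‖e‖ = 1) :
    MeasurePreserving (reflEquiv e c he) volume volume := measurePreserving_refl he

lemma integral_comp_refl (he : ‖e‖ = 1) (f : Euc d → ℝ) :
    ∫ x, f (refl e c x) = ∫ x, f x :=
  (measurePreserving_reflEquiv he).integral_comp' f

lemma integrable_comp_refl (he : ‖e‖ = 1) {f : Euc d → ℝ} (hf : Integrable f) :
    Integrable fun x => f (refl e c x) :=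
  (measurePreserving_refl he).integrable_comp_of_integrable hf

/-- The polarization of `f` with respect to the hyperplane `⟪e, x⟫ = c`. -/
noncomputable def polarize (e : Euc d) (c : ℝ) (f : Euc d → ℝ) (x : Euc d) : ℝ :=
  if 0 ≤ height e c x then max (f x) (f (refl e c x)) else min (f x) (f (refl e c x))

/-- Polarization keeps or swaps the two values on a reflected pair, so quantities symmetric in the
pair are preserved. -/
lemma polarize_pair (he : ‖e‖ = 1) (f : Euc d → ℝ) (x : Euc d) :
    (polarize e c f x = f x ∧ polarize e c f (refl e c x) = f (refl e c x)) ∨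
    (polarize e c f x = f (refl e c x) ∧ polarize e c f (refl e c x) = f x) := by
  unfold polarize
  rw [height_refl he, refl_refl he]
  rcases lt_trichotomy (height e c x) 0 with h | h | h
  · rw [if_neg h.not_ge, if_pos (by linarith)]
    rcases le_total (f x) (f (refl e c x)) with h' | h' <;> simp [h']
  · rw [refl_of_height_eq_zero h]; simp
  · rw [if_pos h.le, if_neg (by linarith)]
    rcases le_total (f x) (f (refl e c x)) with h' | h' <;> simp [h']

lemma polarize_of_pos (he : ‖e‖ = 1) (f : Euc d → ℝ) {x : Euc d} (h : 0 < height e c x) :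
    polarize e c f x = max (f x) (f (refl e c x)) ∧
      polarize e c f (refl e c x) = min (f x) (f (refl e c x)) := by
  unfold polarize
  rw [height_refl he, refl_refl he, if_pos h.le, if_neg (by linarith), min_comm (f (refl e c x))]
  exact ⟨rfl, rfl⟩

lemma polarize_of_neg (he : ‖e‖ = 1) (f : Euc d → ℝ) {x : Euc d} (h : height e c x < 0) :
    polarize e c f x = min (f x) (f (refl e c x)) ∧
      polarize e c f (refl e c x) = max (f x) (f (refl e c x)) := by
  unfold polarize
  rw [height_refl he, refl_refl he, if_neg h.not_ge, if_pos (by linarith),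
    max_comm (f (refl e c x))]
  exact ⟨rfl, rfl⟩

lemma measurable_polarize {f : Euc d → ℝ} (hf : Continuous f) : Measurable (polarize e c f) := by
  have h1 : Continuous fun x => f (refl e c x) := hf.comp continuous_refl
  exact Measurable.ite (measurableSet_le measurable_const continuous_height.measurable)
    (hf.max h1).measurable (hf.min h1).measurable

lemma polarize_nonneg (he : ‖e‖ = 1) {f : Euc d → ℝ} (hf : ∀ x, 0 ≤ f x) (x : Euc d) :
    0 ≤ polarize e c f x := by
  rcases polarize_pair he f x with h | h <;> rw [h.1] <;> exact hf _

lemma memLp_polarize (he : ‖e‖ = 1) {f : Euc d → ℝ} (hf : Continuous f) (hf0 : ∀ x, 0 ≤ f x)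
    {p : ENNReal} (hp : MemLp f p volume) : MemLp (polarize e c f) p volume := by
  have hp' : MemLp (fun x => f x + f (refl e c x)) p volume :=
    hp.add (hp.comp_measurePreserving (measurePreserving_refl he))
  refine hp'.mono (measurable_polarize hf).aestronglyMeasurable (ae_of_all _ fun x => ?_)
  have h1 := hf0 x
  have h2 := hf0 (refl e c x)
  rw [Real.norm_of_nonneg (polarize_nonneg he hf0 x), Real.norm_of_nonneg (by linarith)]
  rcases polarize_pair he f x with h | h <;> rw [h.1] <;> linarith

/-- Both integrands have the same sum over each reflected pair, and the reflection preserves volume.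
-/
lemma integral_polarize (he : ‖e‖ = 1) (f : Euc d → ℝ) (φ : ℝ → ℝ)
    (h1 : Integrable fun x => φ (f x)) (h2 : Integrable fun x => φ (polarize e c f x)) :
    ∫ x, φ (polarize e c f x) = ∫ x, φ (f x) := by
  have e1 : ∫ x, (φ (polarize e c f x) + φ (polarize e c f (refl e c x))) =
      ∫ x, (φ (f x) + φ (f (refl e c x))) := by
    refine integral_congr_ae (ae_of_all _ fun x => ?_)
    rcases polarize_pair (c := c) he f x with h | h
    · simp only [h.1, h.2]
    · simp only [h.1, h.2, add_comm]
  rw [integral_add h2 (integrable_comp_refl (f := fun x => φ (polarize e c f x)) he h2),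
    integral_add h1 (integrable_comp_refl (f := fun x => φ (f x)) he h1),
    integral_comp_refl he (fun x => φ (f x)),
    integral_comp_refl he (fun x => φ (polarize e c f x))] at e1
  linarith

lemma polarize_admissible (he : ‖e‖ = 1) {f : Euc d → ℝ} (hf : Continuous f)
    (hf0 : ∀ x, 0 ≤ f x) {m M : ℝ} (hadm : f ∈ admissible d m M) :
    polarize e c f ∈ admissible d m M := by
  have h1 := memLp_polarize (c := c) he hf hf0 hadm.1
  refine ⟨h1, memLp_polarize he hf hf0 hadm.2.1, ae_of_all _ (polarize_nonneg he hf0), ?_⟩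
  rw [← hadm.2.2.2]
  exact integral_polarize he f id (memLp_one_iff_integrable.1 hadm.1)
    (memLp_one_iff_integrable.1 h1)

/-- The integrand of the interaction energy, summed over the four reflected pairs of points. -/
noncomputable def pairInteraction (W : Euc d → ℝ) (e : Euc d) (c : ℝ) (g : Euc d → ℝ)
    (p : Euc d × Euc d) : ℝ :=
  (g p.1 * g p.2 + g (refl e c p.1) * g (refl e c p.2)) * W (p.1 - p.2) +
    (g p.1 * g (refl e c p.2) + g (refl e c p.1) * g p.2) * W (p.1 - refl e c p.2)

/-- Reflecting either variable preserves the product measure, which gives four copies of the energy;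
their kernels take only two values since `W` is radial. -/
lemma pairInteraction_integral (he : ‖e‖ = 1) (hW : AttractiveKernel W) {g : Euc d → ℝ}
    (hg : MemLp g 2 volume) :
    Integrable (pairInteraction W e c g) (volume.prod volume) ∧
      ∫ p, pairInteraction W e c g p ∂(volume.prod volume) = 4 * interaction W g g := by
  have hi := integrable_interaction hW.integrable hg hg
  set F : Euc d × Euc d → ℝ := fun p => g p.1 * (g p.2 * W (p.1 - p.2)) with hF
  have hσ := measurePreserving_reflEquiv (c := c) he
  have hid := (MeasurePreserving.id (volume : Measure (Euc d)))
  have m1 : MeasurePreserving ((reflEquiv e c he).prodCongr (MeasurableEquiv.refl (Euc d)))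
      (volume.prod volume) (volume.prod volume) := hσ.prod hid
  have m2 : MeasurePreserving ((MeasurableEquiv.refl (Euc d)).prodCongr (reflEquiv e c he))
      (volume.prod volume) (volume.prod volume) := hid.prod hσ
  have m3 : MeasurePreserving ((reflEquiv e c he).prodCongr (reflEquiv e c he))
      (volume.prod volume) (volume.prod volume) := hσ.prod hσ
  have i1 := m1.integrable_comp_of_integrable hi
  have i2 := m2.integrable_comp_of_integrable hi
  have i3 := m3.integrable_comp_of_integrable hi
  have s1 := m1.integral_comp' F
  have s2 := m2.integral_comp' F
  have s3 := m3.integral_comp' F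
  have hsum : pairInteraction W e c g = fun p => ((F p + F (refl e c p.1, p.2)) +
      (F (p.1, refl e c p.2) + F (refl e c p.1, refl e c p.2))) := by
    funext p
    simp only [pairInteraction, hF]
    rw [hW.radial (refl e c p.1 - refl e c p.2) (p.1 - p.2) (norm_refl_sub_refl he _ _),
      hW.radial (refl e c p.1 - p.2) (p.1 - refl e c p.2) (norm_refl_sub he _ _)]
    ring
  have i1' : Integrable (fun p : Euc d × Euc d => F (refl e c p.1, p.2))
    (volume.prod volume) := i1
  have i2' : Integrable (fun p : Euc d × Euc d => F (p.1, refl e c p.2))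
    (volume.prod volume) := i2
  have i3' : Integrable (fun p : Euc d × Euc d => F (refl e c p.1, refl e c p.2))
    (volume.prod volume) := i3
  have s1' : ∫ p : Euc d × Euc d, F (refl e c p.1, p.2) ∂(volume.prod volume) =
    ∫ p, F p ∂(volume.prod volume) := s1
  have s2' : ∫ p : Euc d × Euc d, F (p.1, refl e c p.2) ∂(volume.prod volume) =
    ∫ p, F p ∂(volume.prod volume) := s2
  have s3' : ∫ p : Euc d × Euc d, F (refl e c p.1, refl e c p.2) ∂(volume.prod volume) =
    ∫ p, F p ∂(volume.prod volume) := s3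
  rw [hsum]
  refine ⟨(hi.add i1').add (i2'.add i3'), ?_⟩
  have e1 := integral_add (hi.add i1') (i2'.add i3')
  have e2 := integral_add hi i1'
  have e3 := integral_add i2' i3'
  simp only [Pi.add_apply] at e1 e2 e3
  rw [e1, e2, e3, s1', s2', s3', interaction]
  ring

/-- The kernel inequality behind polarization: reflected points on the same side are farther. -/
lemma AttractiveKernel.le_refl_of_pos (hW : AttractiveKernel W) (he : ‖e‖ = 1) {x y : Euc d}
    (hxy : x ≠ y) (h : 0 ≤ height e c x * height e c y) :
    W (x - y) ≤ W (x - refl e c y) := by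
  refine hW.mono _ _ (sub_ne_zero.2 hxy) ?_
  rw [← sq_le_sq₀ (norm_nonneg _) (norm_nonneg _), norm_sub_refl_sq he]
  linarith

lemma AttractiveKernel.lt_refl_of_pos (hW : AttractiveKernel W) (he : ‖e‖ = 1) {x y : Euc d}
    (hxy : x ≠ y) (h : 0 < height e c x * height e c y) (h1 : ‖x - y‖ < 1) :
    W (x - y) < W (x - refl e c y) := by
  refine hW.strict _ _ (sub_ne_zero.2 hxy) h1 ?_
  rw [← sq_lt_sq₀ (norm_nonneg _) (norm_nonneg _), norm_sub_refl_sq he]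
  linarith

lemma AttractiveKernel.refl_le_of_neg (hW : AttractiveKernel W) (he : ‖e‖ = 1) {x y : Euc d}
    (hxy : x ≠ refl e c y) (h : height e c x * height e c y ≤ 0) :
    W (x - refl e c y) ≤ W (x - y) := by
  have := hW.le_refl_of_pos (c := c) he hxy (by rw [height_refl he]; linarith)
  rwa [refl_refl he] at this

lemma max_mul_max_add_min_mul_min (a a' b b' : ℝ) :
    a * b + a' * b' ≤ max a a' * max b b' + min a a' * min b b' ∧
      max a a' * min b b' + min a a' * max b b' ≤ a * b + a' * b' := by
  rcases le_total a a' with h | h <;> rcases le_total b b' with h' | h' <;>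
    simp only [h, h', max_eq_left, max_eq_right, min_eq_left, min_eq_right] <;>
    constructor <;> nlinarith [mul_nonneg (sub_nonneg.2 h) (sub_nonneg.2 h')]

lemma max_add_min_mul (a a' b b' : ℝ) :
    (max a a' + min a a') * (max b b' + min b b') = (a + a') * (b + b') := by
  rw [max_add_min, max_add_min]

/-- At fixed total weight, shifting weight towards the smaller kernel value lowers the sum. -/
lemma weighted_pair_le {P Q P' Q' w w' : ℝ} (ht : P' + Q' = P + Q)
    (h : 0 ≤ (P' - P) * (w' - w)) : P' * w + Q' * w' ≤ P * w + Q * w' := by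
  obtain rfl : Q' = P + Q - P' := by linarith
  nlinarith

/-- For two points on the same side, polarization raises the weight of `W (x - y)`, the smaller of
the two kernel values; on opposite sides it lowers that weight and `W (x - y)` is the larger. If a
point lies on the hyperplane nothing changes. The hypotheses keep the uncontrolled value `W 0` out.
-/
lemma pairInteraction_polarize_le (he : ‖e‖ = 1) (hW : AttractiveKernel W) (f : Euc d → ℝ)
    {p : Euc d × Euc d} (h1 : p.1 ≠ p.2) (h2 : p.1 ≠ refl e c p.2) :
    pairInteraction W e c (polarize e c f) p ≤ pairInteraction W e c f p := by
  obtain ⟨x, y⟩ := p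
  simp only [pairInteraction] at h1 h2 ⊢
  have hm := max_mul_max_add_min_mul_min (f x) (f (refl e c x)) (f y) (f (refl e c y))
  have ht := max_add_min_mul (f x) (f (refl e c x)) (f y) (f (refl e c y))
  rcases lt_trichotomy (height e c x) 0 with hx | hx | hx
  · rcases lt_trichotomy (height e c y) 0 with hy | hy | hy
    · have hk := hW.le_refl_of_pos (c := c) he h1 (mul_pos_of_neg_of_neg hx hy).le
      rw [(polarize_of_neg he f hx).1, (polarize_of_neg he f hx).2, (polarize_of_neg he f hy).1,
        (polarize_of_neg he f hy).2]
      exact weighted_pair_le (by linarith) (mul_nonneg (by linarith [hm.1]) (sub_nonneg.2 hk))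
    · have hp : polarize e c f y = f y := by
        have h := polarize_pair (c := c) he f y
        rw [refl_of_height_eq_zero hy] at h
        exact h.elim (·.1) (·.1)
      rw [refl_of_height_eq_zero hy, hp]
      rcases polarize_pair (c := c) he f x with h | h <;> simp only [h.1, h.2, add_comm, le_refl]
    · have hk := hW.refl_le_of_neg (c := c) he h2 (mul_neg_of_neg_of_pos hx hy).le
      rw [(polarize_of_neg he f hx).1, (polarize_of_neg he f hx).2, (polarize_of_pos he f hy).1,
        (polarize_of_pos he f hy).2]
      exact weighted_pair_le (by linarith)
        (mul_nonneg_of_nonpos_of_nonpos (by linarith [hm.2]) (sub_nonpos.2 hk))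
  · have hp : polarize e c f x = f x := by
      rcases polarize_pair (c := c) he f x with h | h <;>
        simpa only [refl_of_height_eq_zero hx] using h.1
    have hk : W (x - refl e c y) = W (x - y) := hW.radial _ _ (by
      rw [← norm_refl_sub he, refl_of_height_eq_zero hx])
    rw [refl_of_height_eq_zero hx, hp, hk]
    rcases polarize_pair (c := c) he f y with h | h <;> simp only [h.1, h.2, add_comm, le_refl]
  · rcases lt_trichotomy (height e c y) 0 with hy | hy | hy
    · have hk := hW.refl_le_of_neg (c := c) he h2 (mul_neg_of_pos_of_neg hx hy).le
      rw [(polarize_of_pos he f hx).1, (polarize_of_pos he f hx).2, (polarize_of_neg he f hy).1,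
        (polarize_of_neg he f hy).2]
      exact weighted_pair_le (by linarith)
        (mul_nonneg_of_nonpos_of_nonpos (by linarith [hm.2]) (sub_nonpos.2 hk))
    · have hp : polarize e c f y = f y := by
        have h := polarize_pair (c := c) he f y
        rw [refl_of_height_eq_zero hy] at h
        exact h.elim (·.1) (·.1)
      rw [refl_of_height_eq_zero hy, hp]
      rcases polarize_pair (c := c) he f x with h | h <;> simp only [h.1, h.2, add_comm, le_refl]
    · have hk := hW.le_refl_of_pos (c := c) he h1 (mul_pos hx hy).le
      rw [(polarize_of_pos he f hx).1, (polarize_of_pos he f hx).2, (polarize_of_pos he f hy).1,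
        (polarize_of_pos he f hy).2]
      exact weighted_pair_le (by linarith) (mul_nonneg (by linarith [hm.1]) (sub_nonneg.2 hk))

lemma pairInteraction_polarize_lt (he : ‖e‖ = 1) (hW : AttractiveKernel W) (f : Euc d → ℝ)
    {x y : Euc d} (hxy : x ≠ y) (hx : 0 < height e c x) (hy : 0 < height e c y)
    (h1 : ‖x - y‖ < 1) (hD : (f x - f (refl e c x)) * (f y - f (refl e c y)) < 0) :
    pairInteraction W e c (polarize e c f) (x, y) < pairInteraction W e c f (x, y) := by
  simp only [pairInteraction]
  have hk := hW.lt_refl_of_pos (c := c) he hxy (mul_pos hx hy) h1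
  rw [(polarize_of_pos he f hx).1, (polarize_of_pos he f hx).2, (polarize_of_pos he f hy).1,
    (polarize_of_pos he f hy).2]
  have key := mul_pos (sub_pos.2 hk) (neg_pos.2 hD)
  rcases le_total (f x) (f (refl e c x)) with h | h <;>
    rcases le_total (f y) (f (refl e c y)) with h' | h' <;>
    simp only [h, h', max_eq_left, max_eq_right, min_eq_left, min_eq_right]
  · exact absurd hD (not_lt.2 (mul_nonneg_of_nonpos_of_nonpos (sub_nonpos.2 h) (sub_nonpos.2 h')))
  · nlinarith
  · nlinarith
  · exact absurd hD (not_lt.2 (mul_nonneg (sub_nonneg.2 h) (sub_nonneg.2 h')))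

lemma ae_prod_sub_ne_zero (hd : 1 ≤ d) :
    ∀ᵐ p ∂((volume : Measure (Euc d)).prod volume), p.1 ≠ p.2 := by
  have : Nonempty (Fin d) := ⟨⟨0, hd⟩⟩
  have h : ∀ᵐ x : Euc d, x ≠ 0 := compl_mem_ae_iff.2 (measure_singleton (0 : Euc d))
  filter_upwards [(quasiMeasurePreserving_sub (volume : Measure (Euc d)) volume).ae h] with p hp
  exact sub_ne_zero.1 hp

/-- The asymmetry of a minimizer with respect to a hyperplane has the same sign at any two points
on one side at distance less than one. -/
lemma asymmetry_mul_nonneg (hd : 1 ≤ d) {ε m M : ℝ} (hm : 2 < m)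
    (hW : AttractiveKernel W) (he : ‖e‖ = 1) {f : Euc d → ℝ} (hf : IsGlobalMinimizer ε m M W f)
    (hfc : Continuous f) (hf0 : ∀ x, 0 ≤ f x) {x y : Euc d} (hx : 0 < height e c x)
    (hy : 0 < height e c y) (hxy : ‖x - y‖ < 1) :
    0 ≤ (f x - f (refl e c x)) * (f y - f (refl e c y)) := by
  by_contra! hD
  have hadm := polarize_admissible (c := c) he hfc hf0 hf.1
  have hE := hf.2 _ hadm
  have h2 := memLp_two hm hf.1.1 hf.1.2.1
  have k2 := memLp_two hm hadm.1 hadm.2.1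
  unfold energy at hE
  rw [integral_mul_conv hW.integrable h2 h2, integral_mul_conv hW.integrable k2 k2,
    integral_polarize he f (fun t => t ^ m) (integrable_rpow_of_memLp hm hf.1.2.1 hf.1.2.2.1)
      (integrable_rpow_of_memLp hm hadm.2.1 hadm.2.2.1)] at hE
  obtain ⟨i1, s1⟩ := pairInteraction_integral (c := c) he hW h2
  obtain ⟨i2, s2⟩ := pairInteraction_integral (c := c) he hW k2
  have hne : ∀ᵐ p ∂((volume : Measure (Euc d)).prod volume), p.1 ≠ refl e c p.2 :=
    ((MeasurePreserving.id volume).prod (measurePreserving_refl (c := c) he)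
      ).quasiMeasurePreserving.ae (ae_prod_sub_ne_zero hd)
  have hnn : 0 ≤ᵐ[(volume : Measure (Euc d)).prod volume]
      fun p => pairInteraction W e c f p - pairInteraction W e c (polarize e c f) p := by
    filter_upwards [ae_prod_sub_ne_zero hd, hne] with p hp1 hp2
    exact sub_nonneg.2 (pairInteraction_polarize_le he hW f hp1 hp2)
  have hzero := (integral_eq_zero_iff_of_nonneg_ae hnn (i1.sub i2)).1 (by
    refine le_antisymm ?_ (integral_nonneg_of_ae hnn)
    rw [integral_sub i1 i2, s1, s2]
    linarith)
  -- Minimality makes the energy deficit vanish almost everywhere, yet it is strictly positive on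
  -- this nonempty open set.
  set U : Set (Euc d × Euc d) := {p | 0 < height e c p.1 ∧ 0 < height e c p.2 ∧
    ‖p.1 - p.2‖ < 1 ∧ p.1 ≠ p.2 ∧
    (f p.1 - f (refl e c p.1)) * (f p.2 - f (refl e c p.2)) < 0} with hU
  have hUo : IsOpen U := by
    simp only [hU, ofPred_and]
    refine IsOpen.inter (isOpen_lt (by fun_prop) (by fun_prop)) <|
      IsOpen.inter (isOpen_lt (by fun_prop) (by fun_prop)) <|
      IsOpen.inter (isOpen_lt (by fun_prop) (by fun_prop)) <|
      IsOpen.inter (isOpen_ne_fun (by fun_prop) (by fun_prop))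
        (isOpen_lt (by fun_prop) (by fun_prop))
  have hUn : (x, y) ∈ U := by
    refine ⟨hx, hy, hxy, ?_, hD⟩
    intro h
    have h' : x = y := h
    subst h'
    exact absurd hD (not_lt.2 (mul_self_nonneg _))
  have hU0 : (volume : Measure (Euc d)).prod volume U = 0 := by
    refine measure_mono_null ?_ (ae_iff.1 hzero)
    rintro ⟨a, b⟩ ⟨h1, h2, h3, h4, h5⟩
    exact (sub_pos.2 (pairInteraction_polarize_lt he hW f h4 h1 h2 h3 h5)).ne'
  exact (hUo.measure_pos _ ⟨_, hUn⟩).ne' hU0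

end

/-! ### Propagation of the sign of the asymmetry through the support -/

section

variable {d : ℕ} {W f : Euc d → ℝ} {e : Euc d} {c l : ℝ}

/-- The asymmetry of `f` with respect to the hyperplane `⟪e, x⟫ = c`. -/
noncomputable def asym (e : Euc d) (c : ℝ) (f : Euc d → ℝ) (x : Euc d) : ℝ :=
  f x - f (refl e c x)

lemma asym_refl (he : ‖e‖ = 1) (x : Euc d) : asym e c f (refl e c x) = - asym e c f x := by
  unfold asym; rw [refl_refl he]; ring

lemma continuous_asym (hf : Continuous f) : Continuous (asym e c f) := by
  unfold asym; fun_prop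

lemma asym_of_height_eq_zero {x : Euc d} (h : height e c x = 0) : asym e c f x = 0 := by
  rw [asym, refl_of_height_eq_zero h, sub_self]

/-- The points on the positive side of the hyperplane where `f` exceeds its reflection. -/
def positiveAsym (e : Euc d) (c : ℝ) (f : Euc d → ℝ) : Set (Euc d) :=
  {x | 0 < height e c x ∧ 0 < asym e c f x}

lemma isOpen_positiveAsym (hf : Continuous f) : IsOpen (positiveAsym e c f) :=
  (isOpen_lt continuous_const continuous_height).inter
    (isOpen_lt continuous_const (continuous_asym hf))

lemma height_nonneg_of_mem_closure {x : Euc d} (hx : x ∈ closure (positiveAsym e c f)) :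
    0 ≤ height e c x :=
  closure_minimal (t := {x | 0 ≤ height e c x}) (fun _ hy => hy.1.le)
    (isClosed_le continuous_const continuous_height) hx

/-- The local sign condition satisfied by the asymmetry of minimizers. -/
def LocallySigned (e : Euc d) (c : ℝ) (f : Euc d → ℝ) : Prop :=
  ∀ x y, 0 < height e c x → 0 < height e c y → ‖x - y‖ < 1 → 0 ≤ asym e c f x * asym e c f y

/-- A point of `positiveAsym` close enough to `x` passes its sign on to `y`. When `y` is on the
negative side, its reflection is no farther from `x`; the product with the height treats both sides
at once. -/
lemma LocallySigned.height_mul_asym_nonneg (hs : LocallySigned e c f) (he : ‖e‖ = 1)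
    {x y : Euc d} (hx : x ∈ closure (positiveAsym e c f)) (hxy : ‖x - y‖ < 1) :
    0 ≤ height e c y * asym e c f y := by
  have key : ∀ y, 0 < height e c y → ‖x - y‖ < 1 → 0 ≤ asym e c f y := by
    intro y hy hxy
    obtain ⟨z, hz, hzx⟩ := Metric.mem_closure_iff.1 hx (1 - ‖x - y‖) (by linarith)
    have h1 : ‖z - y‖ < 1 := by
      have := norm_sub_le_norm_sub_add_norm_sub z x y
      rw [dist_eq_norm, norm_sub_rev] at hzx
      linarith
    exact nonneg_of_mul_nonneg_right (hs z y hz.1 hy h1) hz.2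
  rcases lt_trichotomy (height e c y) 0 with hy | hy | hy
  · have h1 : ‖x - refl e c y‖ < 1 := by
      refine lt_of_le_of_lt ?_ hxy
      rw [← sq_le_sq₀ (norm_nonneg _) (norm_nonneg _), norm_sub_refl_sq he]
      nlinarith [height_nonneg_of_mem_closure hx]
    have h2 := key (refl e c y) (by rw [height_refl he]; linarith) h1
    rw [asym_refl he] at h2
    nlinarith
  · rw [hy, zero_mul]
  · exact mul_nonneg hy.le (key y hy hxy)

/-- The integrand of the difference of the potential at a point and at its reflection. -/
noncomputable def diffIntegrand (W : Euc d → ℝ) (e : Euc d) (c : ℝ) (f : Euc d → ℝ)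
    (x y : Euc d) : ℝ :=
  (W (x - refl e c y) - W (x - y)) * asym e c f y

/-- Symmetrizing the integral under the reflection of `y` replaces `f` by its asymmetry and produces
the factor `1/2`. -/
lemma conv_refl_sub (hW : AttractiveKernel W) (he : ‖e‖ = 1)
    (hint : ∀ x, Integrable fun y => W (x - y) * f y) (x : Euc d) :
    Integrable (diffIntegrand W e c f x) ∧
      conv W f (refl e c x) - conv W f x = 1 / 2 * ∫ y, diffIntegrand W e c f x y := by
  have hk : ∀ y, W (refl e c x - y) = W (x - refl e c y) := fun y =>
    hW.radial _ _ (norm_refl_sub he _ _)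
  have i1 := hint (refl e c x)
  simp only [hk] at i1
  set F : Euc d → ℝ := fun y => W (x - refl e c y) * f y - W (x - y) * f y with hF
  have iF : Integrable F := i1.sub (hint x)
  have iF' := integrable_comp_refl (c := c) he iF
  have e1 : ∫ y, F y = conv W f (refl e c x) - conv W f x := by
    rw [integral_sub i1 (hint x), conv, conv]
    simp only [hk]
  have e2 := integral_comp_refl (c := c) he F
  have e3 : ∀ y, diffIntegrand W e c f x y = F y + F (refl e c y) := by
    intro y
    simp only [hF, diffIntegrand, asym, refl_refl he]; ring
  have e4 : diffIntegrand W e c f x = fun y => F y + F (refl e c y) := funext e3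
  rw [e4]
  refine ⟨iF.add iF', ?_⟩
  rw [integral_add iF iF', e2, e1]; ring

lemma diffIntegrand_nonneg (hW : AttractiveKernel W) (he : ‖e‖ = 1) {x y : Euc d}
    (hx : 0 < height e c x) (hxy : x ≠ y) (hxy' : x ≠ refl e c y)
    (h : 0 ≤ height e c y * asym e c f y) : 0 ≤ diffIntegrand W e c f x y := by
  unfold diffIntegrand
  rcases lt_trichotomy (height e c y) 0 with hy | hy | hy
  · have h1 := hW.refl_le_of_neg he hxy' (mul_neg_of_pos_of_neg hx hy).le
    have h2 : asym e c f y ≤ 0 := by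
      by_contra! h'
      nlinarith
    exact mul_nonneg_of_nonpos_of_nonpos (by linarith) h2
  · rw [asym_of_height_eq_zero hy, mul_zero]
  · have h1 := hW.le_refl_of_pos he hxy (mul_pos hx hy).le
    exact mul_nonneg (by linarith) (nonneg_of_mul_nonneg_right h hy)

lemma ae_ne_and_ne_refl (hd : 1 ≤ d) (he : ‖e‖ = 1) (x : Euc d) :
    ∀ᵐ y, x ≠ y ∧ x ≠ refl e c y := by
  have h : ∀ᵐ y : Euc d, x ≠ y := by
    filter_upwards [ae_sub_ne_zero hd x] with y hy using sub_ne_zero.1 hy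
  filter_upwards [h, (measurePreserving_refl (c := c) he).quasiMeasurePreserving.ae h]
    with y h1 h2 using ⟨h1, h2⟩

/-- The integrand vanishes if both `y` and its reflection are at distance at least one from `x`.
Elsewhere the sign condition makes it nonnegative, and it is positive on the part of `positiveAsym`
in the unit ball about `x`. -/
lemma conv_lt_conv_refl (hd : 1 ≤ d) (hW : AttractiveKernel W) (he : ‖e‖ = 1)
    (hf : Continuous f) (hint : ∀ x, Integrable fun y => W (x - y) * f y)
    (hs : LocallySigned e c f) {x : Euc d} (hx : 0 < height e c x)
    (hxA : x ∈ closure (positiveAsym e c f)) : conv W f x < conv W f (refl e c x) := by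
  obtain ⟨hi, hd2⟩ := conv_refl_sub (c := c) hW he hint x
  have hnn : 0 ≤ᵐ[volume] diffIntegrand W e c f x := by
    filter_upwards [ae_ne_and_ne_refl (c := c) hd he x] with y hy
    by_cases h1 : ‖x - y‖ < 1
    · exact diffIntegrand_nonneg hW he hx hy.1 hy.2 (hs.height_mul_asym_nonneg he hxA h1)
    by_cases h2 : ‖x - refl e c y‖ < 1
    · have := hs.height_mul_asym_nonneg he hxA h2
      rw [height_refl he, asym_refl he, neg_mul_neg] at this
      exact diffIntegrand_nonneg hW he hx hy.1 hy.2 this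
    · simp [diffIntegrand, hW.eq_zero _ (not_lt.1 h1), hW.eq_zero _ (not_lt.1 h2)]
  have hpos : 0 < ∫ y, diffIntegrand W e c f x y := by
    rw [integral_pos_iff_support_of_nonneg_ae hnn hi]
    set U := positiveAsym e c f ∩ Metric.ball x 1 with hU
    have hUo : IsOpen U := (isOpen_positiveAsym hf).inter Metric.isOpen_ball
    have hUne : U.Nonempty := by
      obtain ⟨z, hz, hzx⟩ := Metric.mem_closure_iff.1 hxA 1 one_pos
      exact ⟨z, hz, by rwa [Metric.mem_ball, dist_comm]⟩
    refine (hUo.measure_pos volume hUne).trans_le (measure_mono_ae ?_)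
    filter_upwards [ae_ne_and_ne_refl (c := c) hd he x] with y hxy hyU
    obtain ⟨hy, hyx⟩ := hyU
    have hyx' : ‖x - y‖ < 1 := by rwa [Metric.mem_ball, dist_comm, dist_eq_norm] at hyx
    have := hW.lt_refl_of_pos he hxy.1 (mul_pos hx hy.1) hyx'
    exact (mul_pos (sub_pos.2 this) hy.2).ne'
  linarith

lemma height_sub_le_norm (he : ‖e‖ = 1) (x y : Euc d) :
    height e c x - height e c y ≤ ‖x - y‖ := by
  have h := real_inner_le_norm e (x - y)
  rw [he, one_mul, inner_sub_right] at h
  unfold height; linarith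

/-- A boundary point lemma: near a limit point, on the hyperplane, of the set where `f` exceeds its
reflection, the potential is smaller than its reflection. -/
lemma eventually_conv_lt_conv_refl (hd : 1 ≤ d) (hW : AttractiveKernel W) (he : ‖e‖ = 1)
    (hf : Continuous f) (hfi : Integrable f) (hint : ∀ x, Integrable fun y => W (x - y) * f y)
    (hs : LocallySigned e c f) {x₀ : Euc d} (hx₀ : height e c x₀ = 0)
    (hxA : x₀ ∈ closure (positiveAsym e c f)) :
    ∀ᶠ x in 𝓝 x₀, 0 < height e c x → conv W f x < conv W f (refl e c x) := by
  obtain ⟨z, ⟨hz1, hz2⟩, hzx⟩ := Metric.mem_closure_iff.1 hxA (1 / 2) (by norm_num)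
  have hσx₀ : refl e c x₀ = x₀ := refl_of_height_eq_zero hx₀
  have hai : Integrable (asym e c f) := hfi.sub (integrable_comp_refl he hfi)
  -- On `B` both height and asymmetry are bounded below, so `B` contributes a gain of at least `k`
  -- times its volume, per unit of the height of `x`.
  set B : Set (Euc d) := {y | height e c z / 2 < height e c y ∧ asym e c f z / 2 < asym e c f y} ∩
    Metric.ball x₀ (1 / 2) with hB
  have hBo : IsOpen B := ((isOpen_lt continuous_const continuous_height).inter
    (isOpen_lt continuous_const (continuous_asym hf))).inter Metric.isOpen_ball
  have hzB : z ∈ B := ⟨⟨by linarith, by linarith⟩, by rwa [Metric.mem_ball, dist_comm]⟩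
  have hBt : volume B ≠ ⊤ :=
    ((measure_mono inter_subset_right).trans_lt measure_ball_lt_top).ne
  have hBpos : 0 < volume.real B := ENNReal.toReal_pos (hBo.measure_pos volume ⟨z, hzB⟩).ne' hBt
  -- For `x` within `τ` of `x₀` and `y ∈ B`, the distances from `x` to `y` and to its reflection
  -- then lie in `[τ, 1 - τ]`, where the kernel grows at a definite rate.
  set τ := min (height e c z / 4) (1 / 4) with hτ
  have hτ0 : 0 < τ := by positivity
  have hτ1 : τ ≤ height e c z / 4 := min_le_left _ _
  have hτ2 : τ ≤ 1 / 4 := min_le_right _ _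
  obtain ⟨γ, hγ, hgrowth⟩ := hW.growth τ hτ0
  set k := γ * height e c z * (asym e c f z / 2) with hk
  have hk0 : 0 < k := by positivity
  set I := ∫ y, |asym e c f y| with hI
  have hI0 : 0 ≤ I := integral_nonneg fun y => abs_nonneg _
  -- Chosen so that the loss `2 * η * I` from points beyond unit distance from `x₀`, whose sign is
  -- unknown, stays below the gain from `B`.
  set η := k * volume.real B / (2 * (I + 1)) with hη
  have hη0 : 0 < η := by positivity
  obtain ⟨δ, hδ, -, hflat⟩ := hW.flat η hη0
  filter_upwards [Metric.ball_mem_nhds x₀ (lt_min hδ hτ0)] with x hx hhx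
  have hxx : ‖x - x₀‖ < min δ τ := by rwa [Metric.mem_ball, dist_eq_norm] at hx
  have hxδ : ‖x - x₀‖ < δ := hxx.trans_le (min_le_left _ _)
  have hxτ : ‖x - x₀‖ < τ := hxx.trans_le (min_le_right _ _)
  obtain ⟨hi, hd2⟩ := conv_refl_sub (c := c) hW he hint x
  have hσ : ∀ y, ‖x₀ - refl e c y‖ = ‖x₀ - y‖ := fun y => by rw [← norm_refl_sub he, hσx₀]
  -- Gain and loss are both proportional to the height of `x`, so the comparison survives as `x`
  -- approaches the hyperplane.
  have hlow : ∀ᵐ y, height e c x * (B.indicator (fun _ => k) y - 2 * η * |asym e c f y|) ≤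
      diffIntegrand W e c f x y := by
    filter_upwards [ae_ne_and_ne_refl (c := c) hd he x] with y hy
    have ha := abs_nonneg (asym e c f y)
    by_cases hyB : y ∈ B
    · rw [indicator_of_mem hyB]
      obtain ⟨⟨hy1, hy2⟩, hy3⟩ := hyB
      have hy3' : ‖x₀ - y‖ < 1 / 2 := by rwa [Metric.mem_ball, dist_comm, dist_eq_norm] at hy3
      have hyp : 0 < height e c y := by linarith
      have hsq := norm_sub_refl_sq (c := c) he x y
      set a := ‖x - y‖ with ha'
      set b := ‖x - refl e c y‖ with hb'
      have ha0 : 0 ≤ a := norm_nonneg _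
      have hb0 : 0 ≤ b := norm_nonneg _
      have hab : a ≤ b := by
        rw [← sq_le_sq₀ ha0 hb0, hsq]
        nlinarith [mul_pos hhx hyp]
      have hb1 : b ≤ 1 - τ := by
        have := norm_sub_le_norm_sub_add_norm_sub x x₀ (refl e c y)
        rw [hσ] at this
        linarith
      have haτ : τ ≤ a := by
        have h1 := height_sub_le_norm (c := c) he y x
        have h2 := height_sub_le_norm (c := c) he x x₀
        rw [norm_sub_rev] at h1
        linarith
      have hg := hgrowth (x - y) (x - refl e c y) haτ hab hb1
      -- From `b² - a² = 4 * height x * height y` together with `a + b ≤ 2` and `height y > height z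
      -- / 2`.
      have hba : height e c x * height e c z ≤ b - a := by
        have h1 : (b - a) * (b + a) = 4 * (height e c x * height e c y) := by linarith
        have h2 : (b - a) * (b + a) ≤ (b - a) * 2 :=
          mul_le_mul_of_nonneg_left (by linarith) (by linarith)
        nlinarith
      have hK : γ * (height e c x * height e c z) ≤ W (x - refl e c y) - W (x - y) :=
        (mul_le_mul_of_nonneg_left hba hγ.le).trans hg
      unfold diffIntegrand
      have hprod : γ * (height e c x * height e c z) * (asym e c f z / 2) ≤
          (W (x - refl e c y) - W (x - y)) * asym e c f y :=
        mul_le_mul hK hy2.le (by positivity) ((by positivity :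
          (0 : ℝ) ≤ γ * (height e c x * height e c z)).trans hK)
      have : 0 ≤ height e c x * (2 * η * |asym e c f y|) := by positivity
      rw [mul_sub, hk]
      linarith
    · rw [indicator_of_notMem hyB, zero_sub]
      by_cases hy1 : ‖x₀ - y‖ < 1
      · have h1 := diffIntegrand_nonneg hW he hhx hy.1 hy.2 (hs.height_mul_asym_nonneg he hxA hy1)
        have : 0 ≤ height e c x * (2 * η * |asym e c f y|) := by positivity
        linarith
      · have h1 : 1 ≤ ‖x₀ - y‖ := not_lt.1 hy1
        have t1 := norm_sub_le_norm_sub_add_norm_sub x₀ x y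
        have t2 := norm_sub_le_norm_sub_add_norm_sub x₀ x (refl e c y)
        rw [hσ] at t2
        rw [norm_sub_rev x₀ x] at t1 t2
        have hfl := hflat (x - refl e c y) (x - y) (by linarith) (by linarith)
        have h2 : |‖x - refl e c y‖ - ‖x - y‖| ≤ 2 * height e c x := by
          rw [← norm_refl_sub he]
          refine (abs_norm_sub_norm_le _ _).trans ?_
          rw [sub_sub_sub_cancel_right, norm_refl_sub_self he, abs_of_pos hhx]
        have h3 : |diffIntegrand W e c f x y| ≤ η * (2 * height e c x) * |asym e c f y| := by
          unfold diffIntegrand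
          rw [abs_mul]
          exact mul_le_mul_of_nonneg_right
            (hfl.trans (mul_le_mul_of_nonneg_left h2 hη0.le)) ha
        have := neg_abs_le (diffIntegrand W e c f x y)
        linarith
  have i1 : Integrable (B.indicator fun _ => k) :=
    (integrable_indicator_iff hBo.measurableSet).2 (integrableOn_const hBt)
  have i2 : Integrable fun y => 2 * η * |asym e c f y| := hai.abs.const_mul _
  have hle := integral_mono_ae ((i1.sub i2).const_mul _) hi hlow
  have hcalc : ∫ y, height e c x * (B.indicator (fun _ => k) y - 2 * η * |asym e c f y|) =
      height e c x * (volume.real B * k - 2 * η * I) := by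
    rw [integral_const_mul, integral_sub i1 i2, integral_indicator_const _ hBo.measurableSet,
      integral_const_mul, smul_eq_mul]
  have hgap : 0 < volume.real B * k - 2 * η * I := by
    have : 2 * η * (I + 1) = volume.real B * k := by
      rw [hη]; field_simp
    linarith
  have hle' : height e c x * (volume.real B * k - 2 * η * I) ≤
    ∫ y, diffIntegrand W e c f x y := hcalc ▸ hle
  have := mul_pos hhx hgap
  linarith

lemma dense_height_ne_zero (he : ‖e‖ = 1) : Dense {x : Euc d | height e c x ≠ 0} := by
  intro x
  by_cases hx : height e c x = 0
  · have h1 : inner ℝ e e = (1 : ℝ) := by rw [real_inner_self_eq_norm_sq, he, one_pow]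
    have hlim : Tendsto (fun t : ℝ => x + t • e) (𝓝[≠] 0) (𝓝 x) := by
      have : ContinuousAt (fun t : ℝ => x + t • e) 0 := by fun_prop
      have h2 := this.tendsto
      simp only [zero_smul, add_zero] at h2
      exact h2.mono_left nhdsWithin_le_nhds
    refine mem_closure_of_tendsto hlim ?_
    filter_upwards [self_mem_nhdsWithin] with t ht
    have : height e c (x + t • e) = height e c x + t := by
      simp only [height, inner_add_right, inner_smul_right, h1]; ring
    change height e c (x + t • e) ≠ 0
    rw [this, hx, zero_add]
    exact ht
  · exact subset_closure hx

/-- If the support of an equilibrium is connected, the asymmetry with respect to a hyperplane has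
one sign on each side. -/
lemma IsEquilibrium.asym_sign (hd : 1 ≤ d) (hW : AttractiveKernel W) (he : ‖e‖ = 1)
    (hf : IsEquilibrium W f l) (hs : LocallySigned e c f)
    (hconn : IsPreconnected (closure {x | 0 < f x})) :
    (∀ x, 0 < height e c x → asym e c f x ≤ 0) ∨ (∀ x, 0 < height e c x → 0 ≤ asym e c f x) := by
  set V := conv W f with hV
  set A := positiveAsym e c f with hA
  set G := closure A ∪ refl e c ⁻¹' closure A with hG
  have hGc : IsClosed G := isClosed_closure.union (isClosed_closure.preimage continuous_refl)
  set Q : Set (Euc d) := {x | 0 < f x} with hQ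
  have hQo : IsOpen Q := isOpen_lt continuous_const hf.continuous
  have hnear : ∀ x ∈ closure A, ∀ᶠ z in 𝓝 x, 0 < height e c z → V z < V (refl e c z) := by
    intro x hx
    rcases (height_nonneg_of_mem_closure hx).eq_or_lt with h | h
    · exact eventually_conv_lt_conv_refl hd hW he hf.continuous hf.integrable
        hf.integrable_kernel hs h.symm hx
    · have h1 := conv_lt_conv_refl hd hW he hf.continuous hf.integrable_kernel hs h hx
      have h2 : Continuous fun z => V (refl e c z) := hf.continuous_conv.comp continuous_refl
      filter_upwards [hf.continuous_conv.continuousAt.eventually_lt h2.continuousAt h1]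
        with z hz _ using hz
  -- Relative openness of `G` in the support: near `x` the potentials are strictly ordered off the
  -- hyperplane, hence so are the densities at points of `Q`. Density of these points and closedness
  -- of `G` extend the conclusion to `closure Q`.
  have hlocal : ∀ x ∈ closure Q, x ∈ G → ∀ᶠ z in 𝓝 x, z ∈ closure Q → z ∈ G := by
    intro x hxS hxG
    have hev : ∀ᶠ z in 𝓝 x, (0 < height e c z → V z < V (refl e c z)) ∧
        (height e c z < 0 → V (refl e c z) < V z) := by
      have hrefl : ∀ x', refl e c x' ∈ closure A → ∀ᶠ z in 𝓝 x', height e c z < 0 →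
          V (refl e c z) < V z := by
        intro x' hx'
        have := continuous_refl.continuousAt.eventually (hnear _ hx')
        filter_upwards [this] with z hz hz0
        have := hz (by rw [height_refl he]; linarith)
        rwa [refl_refl he] at this
      have hcase : ∀ x', height e c x' = 0 → refl e c x' = x' := fun x' h =>
        refl_of_height_eq_zero h
      rcases hxG with hx | hx
      · have h0 := height_nonneg_of_mem_closure hx
        rcases h0.eq_or_lt with h | h
        · exact (hnear x hx).and (hrefl x (by rwa [hcase x h.symm]))
        · filter_upwards [hnear x hx, continuous_height.continuousAt.eventually_const_lt h]
            with z h1 h2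
          exact ⟨h1, fun h3 => absurd h3 h2.not_gt⟩
      · have h0 := height_nonneg_of_mem_closure hx
        rw [height_refl he] at h0
        rcases h0.eq_or_lt with h | h
        · have hz : height e c x = 0 := by linarith
          refine (hnear x ?_).and (hrefl x hx)
          rw [mem_preimage, hcase x hz] at hx
          exact hx
        · have h' : height e c x < 0 := by linarith
          filter_upwards [hrefl x hx, continuous_height.continuousAt.eventually_lt_const h']
            with z h1 h2
          exact ⟨fun h3 => absurd h3 h2.not_gt, h1⟩
    obtain ⟨N, hNsub, hNo, hxN⟩ := eventually_nhds_iff.1 hev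
    filter_upwards [hNo.mem_nhds hxN] with z hzN hzS
    have h1 : z ∈ closure (Q ∩ {x | height e c x ≠ 0}) :=
      closure_minimal ((dense_height_ne_zero he).open_subset_closure_inter hQo)
        isClosed_closure hzS
    have h2 := hNo.inter_closure ⟨hzN, h1⟩
    refine closure_minimal ?_ hGc h2
    rintro y ⟨hyN, hyQ, hy0⟩
    have hyV : V y < l := (hf.pos_iff y).1 hyQ
    rcases lt_or_gt_of_ne hy0 with hy | hy
    · have h3 := (hNsub y hyN).2 hy
      have h4 := hf.lt_of_conv_lt (refl e c y) y (h3.trans hyV) h3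
      refine Or.inr (subset_closure ⟨by rw [height_refl he]; linarith, ?_⟩)
      rw [asym, refl_refl he]; linarith
    · have h3 := (hNsub y hyN).1 hy
      have h4 := hf.lt_of_conv_lt y (refl e c y) hyV h3
      exact Or.inl (subset_closure ⟨hy, by rw [asym]; linarith⟩)
  by_contra! hcon
  obtain ⟨⟨a, ha, haD⟩, b, hb, hbD⟩ := hcon
  have haA : a ∈ A := ⟨ha, haD⟩
  have haQ : a ∈ closure Q := by
    refine subset_closure ?_
    have := hf.nonneg (refl e c a)
    rw [asym] at haD
    exact (by linarith : 0 < f a)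
  have hbQ : refl e c b ∈ closure Q := by
    refine subset_closure ?_
    have := hf.nonneg b
    rw [asym] at hbD
    exact (by linarith : 0 < f (refl e c b))
  -- Membership would either give the reflected point nonnegative height or put `b` in `closure A`,
  -- where the sign condition at distance zero contradicts the negative asymmetry of `b`.
  have hbG : refl e c b ∉ G := by
    rintro (h | h)
    · have := height_nonneg_of_mem_closure h
      rw [height_refl he] at this
      linarith
    · rw [mem_preimage, refl_refl he] at h
      have := hs.height_mul_asym_nonneg he h (y := b) (by simp)
      nlinarith
  set u : Set (Euc d) := interior {z | z ∈ closure Q → z ∈ G} with hu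
  have hau : a ∈ u :=
    mem_interior_iff_mem_nhds.2 (hlocal a haQ (Or.inl (subset_closure haA)))
  obtain ⟨z, hzQ, hzu, hzG⟩ := hconn u Gᶜ isOpen_interior hGc.isOpen_compl
    (fun z hz => by
      by_cases h : z ∈ G
      · exact Or.inl (mem_interior_iff_mem_nhds.2 (hlocal z hz h))
      · exact Or.inr h)
    ⟨a, haQ, hau⟩ ⟨_, hbQ, hbG⟩
  exact hzG (interior_subset hzu hzQ)

end

/-! ### From signed asymmetries to radial monotonicity -/

section

variable {d : ℕ} {f : Euc d → ℝ} {e : Euc d} {c : ℝ}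

lemma volume_hyperplane (he : ‖e‖ = 1) (c : ℝ) : volume {x : Euc d | height e c x = 0} = 0 := by
  have h1 : inner ℝ e e = (1 : ℝ) := by rw [real_inner_self_eq_norm_sq, he, one_pow]
  have hs : {x : Euc d | height e c x = 0} =
      (fun x => x + (-c) • e) ⁻¹' ((ℝ ∙ e)ᗮ : Submodule ℝ (Euc d)) := by
    ext x
    simp only [mem_preimage, SetLike.mem_coe, Submodule.mem_orthogonal_singleton_iff_inner_right,
      inner_add_right, inner_smul_right, h1]
    change height e c x = 0 ↔ _
    rw [height]
    constructor <;> intro h <;> linarith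
  rw [hs, measure_preimage_add_right]
  refine Measure.addHaar_submodule _ _ fun h => ?_
  have : e ∈ (ℝ ∙ e)ᗮ := h ▸ Submodule.mem_top
  rw [Submodule.mem_orthogonal_singleton_iff_inner_right, h1] at this
  exact one_ne_zero this

lemma measurableSet_height_pos : MeasurableSet {x : Euc d | 0 < height e c x} :=
  (isOpen_lt continuous_const continuous_height).measurableSet

lemma measurableSet_height_neg : MeasurableSet {x : Euc d | height e c x < 0} :=
  (isOpen_lt continuous_height continuous_const).measurableSet

lemma setIntegral_halves (he : ‖e‖ = 1) (hf : Integrable f) :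
    (∫ x in {x | 0 < height e c x}, f x) + ∫ x in {x | height e c x < 0}, f x = ∫ x, f x := by
  rw [← integral_indicator measurableSet_height_pos, ← integral_indicator measurableSet_height_neg,
    ← integral_add (hf.indicator measurableSet_height_pos) (hf.indicator measurableSet_height_neg)]
  refine integral_congr_ae ?_
  have h0 : ∀ᵐ x : Euc d, x ∉ {x : Euc d | height e c x = 0} :=
    measure_eq_zero_iff_ae_notMem.1 (volume_hyperplane he c)
  filter_upwards [h0] with x hx
  have hx' : height e c x ≠ 0 := hx
  rcases lt_or_gt_of_ne hx' with h | h
  · simp [indicator, mem_ofPred_eq, h, h.not_gt]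
  · simp [indicator, mem_ofPred_eq, h, h.not_gt]

/-- The integrated asymmetry is the difference of the masses of the two sides; this is how a mass
comparison decides its sign. -/
lemma setIntegral_asym (he : ‖e‖ = 1) (hf : Integrable f) :
    ∫ x in {x | 0 < height e c x}, asym e c f x =
      2 * (∫ x in {x | 0 < height e c x}, f x) - ∫ x, f x := by
  have h1 : ∫ x in {x | 0 < height e c x}, f (refl e c x) =
      ∫ x in {x | height e c x < 0}, f x := by
    rw [← integral_indicator measurableSet_height_pos,
      ← integral_indicator measurableSet_height_neg,
      ← integral_comp_refl (c := c) he ({x | height e c x < 0}.indicator f)]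
    refine integral_congr_ae (ae_of_all _ fun x => ?_)
    simp only [indicator, mem_ofPred_eq, height_refl he, neg_neg_iff_pos]
  have h2 := setIntegral_halves (c := c) he hf
  simp only [asym]
  rw [integral_sub hf.integrableOn (integrable_comp_refl he hf).integrableOn, h1]
  linarith

lemma eq_zero_of_setIntegral_nonpos {g : Euc d → ℝ} {U : Set (Euc d)} (hU : IsOpen U)
    (hg : Continuous g) (hgi : Integrable g) (h0 : ∀ x ∈ U, 0 ≤ g x)
    (h : ∫ x in U, g x ≤ 0) : ∀ x ∈ U, g x = 0 := by
  have hnn : 0 ≤ᵐ[volume.restrict U] g := by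
    filter_upwards [ae_restrict_mem hU.measurableSet] with x hx using h0 x hx
  have h1 := (setIntegral_eq_zero_iff_of_nonneg_ae hnn hgi.integrableOn).1
    (le_antisymm h (integral_nonneg_of_ae hnn))
  exact Measure.eqOn_open_of_ae_eq h1 hU hg.continuousOn continuousOn_const

/-- The asymmetry of `f` has one sign on each side of every hyperplane. -/
def AsymSigned (f : Euc d → ℝ) : Prop :=
  ∀ (e : Euc d) (c : ℝ), ‖e‖ = 1 → (∀ x, 0 < height e c x → asym e c f x ≤ 0) ∨
    ∀ x, 0 < height e c x → 0 ≤ asym e c f x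

lemma integrable_asym (he : ‖e‖ = 1) (hf : Integrable f) : Integrable (asym e c f) :=
  hf.sub (integrable_comp_refl he hf)

/-- A side with at least half the mass has nonnegative integrated asymmetry, so a nonpositive
continuous asymmetry must vanish there. -/
lemma asym_eq_zero_of_nonpos (he : ‖e‖ = 1) (hfc : Continuous f) (hf : Integrable f)
    (h : ∀ x, 0 < height e c x → asym e c f x ≤ 0)
    (hm : (∫ x, f x) ≤ 2 * ∫ x in {x | 0 < height e c x}, f x) {x : Euc d}
    (hx : 0 < height e c x) : asym e c f x = 0 := by
  refine neg_eq_zero.1 (eq_zero_of_setIntegral_nonpos (g := fun x => - asym e c f x)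
    (isOpen_lt continuous_const continuous_height) (continuous_asym hfc).neg
    (integrable_asym he hf).neg (fun x hx => neg_nonneg.2 (h x hx)) ?_ x hx)
  rw [integral_neg, setIntegral_asym he hf]
  linarith

/-- A hyperplane which halves the mass is a hyperplane of symmetry. -/
lemma AsymSigned.comp_refl_eq (hs : AsymSigned f) (he : ‖e‖ = 1) (hfc : Continuous f)
    (hf : Integrable f) (hm : 2 * (∫ x in {x | 0 < height e c x}, f x) = ∫ x, f x) (x : Euc d) :
    f (refl e c x) = f x := by
  have key : ∀ x, 0 < height e c x → asym e c f x = 0 := by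
    intro x hx
    rcases hs e c he with h | h
    · exact asym_eq_zero_of_nonpos he hfc hf h hm.ge hx
    · refine eq_zero_of_setIntegral_nonpos (isOpen_lt continuous_const continuous_height)
        (continuous_asym hfc) (integrable_asym he hf) h ?_ x hx
      rw [setIntegral_asym he hf]
      linarith
  rcases lt_trichotomy (height e c x) 0 with hx | hx | hx
  · have := key (refl e c x) (by rw [height_refl he]; linarith)
    rw [asym, refl_refl he] at this
    linarith
  · rw [refl_of_height_eq_zero hx]
  · have := key x hx
    rw [asym] at this
    linarith

/-- In every direction there is a hyperplane which halves the mass. -/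
lemma exists_halving (he : ‖e‖ = 1) (hf : Integrable f) (hM : 0 < ∫ x, f x) :
    ∃ c, 2 * (∫ x in {x | 0 < height e c x}, f x) = ∫ x, f x := by
  set F : ℝ → Euc d → ℝ := fun c => {x | 0 < height e c x}.indicator f with hF
  have hFm : ∀ c, AEStronglyMeasurable (F c) volume := fun c =>
    hf.aestronglyMeasurable.indicator measurableSet_height_pos
  have hFb : ∀ c, ∀ᵐ x, ‖F c x‖ ≤ ‖f x‖ := fun c =>
    ae_of_all _ fun x => norm_indicator_le_norm_self _ _
  have hFpos : ∀ c x, c < inner ℝ e x → F c x = f x := fun c x h =>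
    indicator_of_mem (show x ∈ {x | 0 < height e c x} from sub_pos.2 h) _
  have hFneg : ∀ c x, inner ℝ e x ≤ c → F c x = 0 := fun c x h =>
    indicator_of_notMem (show x ∉ {x | 0 < height e c x} from (sub_nonpos.2 h).not_gt) _
  -- Hyperplanes are null sets, so the mass of the half-space varies continuously with `c`; the
  -- intermediate value theorem applies between the limits `∫ f` and `0`.
  have hcont : Continuous fun c => ∫ x, F c x := by
    rw [continuous_iff_continuousAt]
    intro c₀
    refine continuousAt_of_dominated (Eventually.of_forall hFm) (Eventually.of_forall hFb)
      hf.norm ?_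
    have h0 : ∀ᵐ x : Euc d, x ∉ {x : Euc d | height e c₀ x = 0} :=
      measure_eq_zero_iff_ae_notMem.1 (volume_hyperplane he c₀)
    filter_upwards [h0] with x hx
    have hx' : inner ℝ e x ≠ c₀ := fun h => hx (sub_eq_zero.2 h)
    rcases lt_or_gt_of_ne hx' with h | h
    · refine (continuousAt_const (y := (0 : ℝ))).congr ?_
      filter_upwards [lt_mem_nhds h] with c hc using (hFneg c x (le_of_lt hc)).symm
    · refine (continuousAt_const (y := f x)).congr ?_
      filter_upwards [gt_mem_nhds h] with c hc using (hFpos c x hc).symm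
  have htop : Tendsto (fun c => ∫ x, F c x) atTop (𝓝 0) := by
    rw [← integral_zero (Euc d) ℝ (μ := volume)]
    refine tendsto_integral_filter_of_dominated_convergence _ (Eventually.of_forall hFm)
      (Eventually.of_forall hFb) hf.norm (ae_of_all _ fun x => ?_)
    refine tendsto_const_nhds.congr' ?_
    filter_upwards [eventually_ge_atTop (inner ℝ e x)] with c hc using (hFneg c x hc).symm
  have hbot : Tendsto (fun c => ∫ x, F c x) atBot (𝓝 (∫ x, f x)) := by
    refine tendsto_integral_filter_of_dominated_convergence _ (Eventually.of_forall hFm)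
      (Eventually.of_forall hFb) hf.norm (ae_of_all _ fun x => ?_)
    refine tendsto_const_nhds.congr' ?_
    filter_upwards [eventually_lt_atBot (inner ℝ e x)] with c hc using (hFpos c x hc).symm
  obtain ⟨a, ha⟩ := (htop.eventually_lt_const (half_pos hM)).exists
  obtain ⟨b, hb⟩ := (hbot.eventually_const_lt (half_lt_self hM)).exists
  obtain ⟨c, hc⟩ := mem_range_of_exists_le_of_exists_ge hcont ⟨a, ha.le⟩ ⟨b, hb.le⟩
  refine ⟨c, ?_⟩
  rw [← integral_indicator measurableSet_height_pos]
  simp only [hF] at hc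
  linarith

/-- A density with signed asymmetries has a centre of symmetry. -/
lemma AsymSigned.exists_centre (hs : AsymSigned f) (hfc : Continuous f) (hf : Integrable f)
    (hM : 0 < ∫ x, f x) : ∃ x₀ : Euc d, ∀ x, f ((x₀ + x₀) - x) = f x := by
  have hne : ∀ i : Fin d, ‖(EuclideanSpace.single i (1 : ℝ) : Euc d)‖ = 1 := fun i => by simp
  choose c hc using fun i : Fin d => exists_halving (hne i) hf hM
  have hsymm := fun i => hs.comp_refl_eq (hne i) hfc hf (hc i)
  refine ⟨WithLp.toLp 2 c, fun x => ?_⟩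
  -- Coordinate reflections are composed one at a time; all of them together form the point
  -- reflection through the centre.
  have key : ∀ s : Finset (Fin d),
      f (WithLp.toLp 2 fun i => if i ∈ s then c i + c i - x i else x i) = f x := by
    intro s
    induction s using Finset.induction_on with
    | empty => simp
    | insert a s ha ih =>
      rw [← ih, ← hsymm a]
      congr 1
      ext i
      by_cases hi : i = a
      · subst hi
        simp [refl, height, ha, EuclideanSpace.inner_single_left]
        ring
      · simp [refl, height, hi]
  rw [← key Finset.univ]
  congr 1
  ext i
  simp

lemma setIntegral_half_of_centre (he : ‖e‖ = 1) (hf : Integrable f) {x₀ : Euc d}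
    (hx₀ : ∀ x, f ((x₀ + x₀) - x) = f x) (h0 : height e c x₀ = 0) :
    2 * (∫ x in {x | 0 < height e c x}, f x) = ∫ x, f x := by
  have hh : ∀ x, height e c ((x₀ + x₀) - x) = - height e c x := by
    intro x
    simp only [height, inner_sub_right, inner_add_right] at h0 ⊢
    linarith
  have h1 : ∫ x in {x | 0 < height e c x}, f x = ∫ x in {x | height e c x < 0}, f x := by
    rw [← integral_indicator measurableSet_height_pos,
      ← integral_indicator measurableSet_height_neg,
      ← integral_sub_left_eq_self ({x | height e c x < 0}.indicator f) volume (x₀ + x₀)]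
    refine integral_congr_ae (ae_of_all _ fun x => ?_)
    simp only [indicator, mem_ofPred_eq, hh, hx₀, neg_neg_iff_pos]
  have := setIntegral_halves (c := c) he hf
  linarith

/-- The bisector of two distinct points. -/
lemma exists_bisector {x y : Euc d} (hxy : x ≠ y) :
    ∃ (e : Euc d) (c : ℝ), ‖e‖ = 1 ∧ refl e c x = y ∧ 0 < height e c x ∧
      ∀ z, ‖z - y‖ ^ 2 - ‖z - x‖ ^ 2 = 2 * ‖x - y‖ * height e c z := by
  have hr : 0 < ‖x - y‖ := norm_pos_iff.2 (sub_ne_zero.2 hxy)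
  set r := ‖x - y‖ with hrdef
  set e : Euc d := r⁻¹ • (x - y) with he
  set c : ℝ := (‖x‖ ^ 2 - ‖y‖ ^ 2) / (2 * r) with hc
  have hform : ∀ z, ‖z - y‖ ^ 2 - ‖z - x‖ ^ 2 = 2 * r * height e c z := by
    intro z
    rw [height, norm_sub_sq_real, norm_sub_sq_real, he, inner_smul_left, inner_sub_left, hc,
      real_inner_comm z x, real_inner_comm z y]
    simp only [conj_trivial]
    field_simp
    ring
  have hx : height e c x = r / 2 := by
    have := hform x
    rw [sub_self, norm_zero, ← hrdef] at this
    have h2 : r * r = r * (2 * height e c x) := by linarith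
    have := mul_left_cancel₀ hr.ne' h2
    linarith
  refine ⟨e, c, norm_smul_inv_norm (sub_ne_zero.2 hxy), ?_, by rw [hx]; positivity, hform⟩
  rw [refl, hx, he, mul_div_cancel₀ r two_ne_zero, smul_smul, mul_inv_cancel₀ hr.ne']
  module

/-- A density all of whose asymmetries are signed is radially decreasing. -/
lemma AsymSigned.isRadiallyDecreasing (hd : 1 ≤ d) (hs : AsymSigned f) (hfc : Continuous f)
    (hf : Integrable f) (hf0 : ∀ x, 0 ≤ f x) (hM : 0 < ∫ x, f x) : IsRadiallyDecreasing f := by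
  obtain ⟨x₀, hx₀⟩ := hs.exists_centre hfc hf hM
  -- The bisector of two points equidistant from `x₀` passes through `x₀`, so by central symmetry it
  -- halves the mass.
  have hsphere : ∀ x y, ‖x - x₀‖ = ‖y - x₀‖ → f x = f y := by
    intro x y hxy
    by_cases hne : x = y
    · rw [hne]
    obtain ⟨e, c, he, hr, -, hform⟩ := exists_bisector hne
    have h0 : height e c x₀ = 0 := by
      have h1 := hform x₀
      rw [norm_sub_rev x₀ y, norm_sub_rev x₀ x, hxy, sub_self, eq_comm] at h1
      refine (mul_eq_zero.1 h1).resolve_left ?_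
      have := norm_pos_iff.2 (sub_ne_zero.2 hne)
      positivity
    rw [← hr, hs.comp_refl_eq he hfc hf (setIntegral_half_of_centre he hf hx₀ h0)]
  have hmono : ∀ x y, ‖x - x₀‖ < ‖y - x₀‖ → f y ≤ f x := by
    intro x y hxy
    have hne : x ≠ y := by rintro rfl; exact lt_irrefl _ hxy
    obtain ⟨e, c, he, hr, hx, hform⟩ := exists_bisector hne
    have h0 : 0 < height e c x₀ := by
      have h1 := hform x₀
      rw [norm_sub_rev x₀ y, norm_sub_rev x₀ x] at h1
      have h2 : 0 < 2 * ‖x - y‖ * height e c x₀ := by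
        rw [← h1, sub_pos]
        gcongr
      exact pos_of_mul_pos_right h2 (by positivity)
    rcases hs e c he with h | h
    · have hmass : (∫ x, f x) ≤ 2 * ∫ x in {x | 0 < height e c x}, f x := by
        rw [← setIntegral_half_of_centre (c := inner ℝ e x₀) he hf hx₀ (sub_self _)]
        refine mul_le_mul_of_nonneg_left ?_ zero_le_two
        refine setIntegral_mono_set hf.integrableOn (ae_of_all _ hf0) ?_
        refine ae_of_all _ fun z hz => ?_
        have hz' : 0 < height e (inner ℝ e x₀) z := hz
        change 0 < height e c z
        simp only [height] at hz' h0 ⊢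
        linarith
      have := asym_eq_zero_of_nonpos he hfc hf h hmass hx
      rw [asym, hr] at this
      linarith
    · have := h x hx
      rw [asym, hr] at this
      linarith
  set u : Euc d := EuclideanSpace.single ⟨0, hd⟩ 1 with hu
  have hu1 : ‖u‖ = 1 := by simp [hu]
  have hnorm : ∀ r : ℝ, 0 ≤ r → ‖x₀ + r • u - x₀‖ = r := fun r hr => by
    rw [add_sub_cancel_left, norm_smul, hu1, mul_one, Real.norm_of_nonneg hr]
  refine ⟨hf0, x₀, fun r => f (x₀ + r • u), fun x => ?_, fun r hr s hs' hrs => ?_⟩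
  · exact hsphere _ _ (hnorm _ (norm_nonneg _)).symm
  · rcases hrs.eq_or_lt with h | h
    · rw [h]
    · exact hmono _ _ (by rwa [hnorm r hr, hnorm s hs'])

/-- Nonempty open sets have positive volume, so for a continuous representative the
measure-theoretic and topological supports agree. -/
lemma essSupport_eq_closure {ρ f : Euc d → ℝ} (hf : Continuous f) (hf0 : ∀ x, 0 ≤ f x)
    (h : ρ =ᵐ[volume] f) : essSupport ρ = closure {x | 0 < f x} := by
  have hms : ∀ U : Set (Euc d), volume (U ∩ {y | ρ y ≠ 0}) = volume (U ∩ {y | 0 < f y}) := by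
    intro U
    refine measure_congr ?_
    filter_upwards [h] with y hy
    refine propext (and_congr_right fun _ => ?_)
    change ρ y ≠ 0 ↔ 0 < f y
    rw [hy]
    exact ⟨fun h => (hf0 y).lt_of_ne' h, fun h => h.ne'⟩
  ext x
  rw [mem_closure_iff_nhds]
  change (∀ U ∈ 𝓝 x, 0 < volume (U ∩ {y | ρ y ≠ 0})) ↔ _
  simp only [hms]
  refine ⟨fun hx U hU => nonempty_of_measure_ne_zero (hx U hU).ne', fun hx U hU => ?_⟩
  obtain ⟨V, hVU, hVo, hxV⟩ := mem_nhds_iff.1 hU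
  have h1 : IsOpen (V ∩ {y | 0 < f y}) := hVo.inter (isOpen_lt continuous_const hf)
  exact (h1.measure_pos volume (hx V (hVo.mem_nhds hxV))).trans_le
    (measure_mono (inter_subset_inter_left _ hVU))

end

end AggDiff

theorem theorem2p3 (d : ℕ) (hd : 1 ≤ d) (ε m M : ℝ) (hε : 0 < ε) (hm : 2 < m) (hM : 0 < M)
    (W : EuclideanSpace ℝ (Fin d) → ℝ) (ω : ℝ → ℝ)
    (hW1 : AggDiff.CondW1 W ω) (hW2 : AggDiff.CondW2 d ω) (hW4 : AggDiff.CondW4 ω)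
    (ρ : EuclideanSpace ℝ (Fin d) → ℝ)
    (hρ : AggDiff.IsGlobalMinimizer ε m M W ρ)
    (hsupp : IsConnected (AggDiff.essSupport ρ)) :
    ∃ f : EuclideanSpace ℝ (Fin d) → ℝ,
      AggDiff.IsRadiallyDecreasing f ∧ ρ =ᵐ[volume] f := by
  have hW := AggDiff.attractiveKernel hd hW1 hW2 hW4
  obtain ⟨f, l, hf, hρf⟩ := AggDiff.exists_equilibrium hd hε hm hM hW hρ
  have hmin := hρ.congr hρf
  rw [AggDiff.essSupport_eq_closure hf.continuous hf.nonneg hρf] at hsupp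
  have hsigned : AggDiff.AsymSigned f := fun e c he =>
    hf.asym_sign hd hW he (fun _ _ hx hy hxy => AggDiff.asymmetry_mul_nonneg hd hm hW he hmin
      hf.continuous hf.nonneg hx hy hxy) hsupp.isPreconnected
  exact ⟨f, hsigned.isRadiallyDecreasing hd hf.continuous hf.integrable hf.nonneg
    (by rw [hmin.1.2.2.2]; exact hM), hρf⟩
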